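/- Let $n,p\ge 1$, $0<\mu$, $L\in\mathbb R$. Let $f_1,\dots,f_n:\mathbb R^p\to\mathbb R$ be differentiable with $\langle\nabla f_i(x)-\nabla f_i(x'),x-x'\rangle\ge\mu\|x-x'\|_2^2$ and $\|\nabla f_i(x)-\nabla f_i(x')\|_2\le L\|x-x'\|_2$ for all $i,x,x'$. Let $R,C\in\mathbb R^{n\times n}$ be nonnegative with positive diagonal entries, $R\mathbf 1=\mathbf 1$, $\mathbf 1^{\top}C=\mathbf 1^{\top}$. For a nonnegative matrix $M$ let $\mathcal G_M$ be the directed graph on $\{1,\dots,n\}$ with an edge from $j$ to $i$ iff $M_{ij}>0$, and suppose that $\mathcal G_R$ and $\mathcal G_{C^{\top}}$ contain directed spanning trees with a common root. Then $\sum_i f_i$ has a unique minimizer $x^*$; there are a unique $u\ge0$ with $u^{\top}R=u^{\top}$, $u^{\top}\mathbf 1=n$, and a unique $v\ge 0$ with $Cv=v$, $\mathbf 1^{\top}v=n$; and there are norms $\|\cdot\|_R,\|\cdot\|_C$ on $\mathbb R^n$ and constants $\delta_{R,C},\delta_{C,2}>0$ such that, with the induced matrix norms, $$\sigma_R:=\Big\|R-\tfrac{\mathbf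 1u^{\top}}n\Big\|_R<1,\qquad \sigma_C:=\Big\|C-\tfrac{v\mathbf 1^{\top}}n\Big\|_C<1,$$ and for all $\mathbf x\in\mathbb R^{n\times p}$: $\|\mathbf x\|_2\le\|\mathbf x\|_R$, $\|\mathbf x\|_2\le\|\mathbf x\|_C$, $\|\mathbf x\|_R\le\delta_{R,C}\|\mathbf x\|_C$, $\|\mathbf x\|_C\le\delta_{C,2}\|\mathbf x\|_2$. (A norm on $\mathbb R^n$ is extended to $\mathbb R^{n\times p}$ as the $2$-norm of the vector of the norms of the columns.) Fix any such norms and constants. Let $$c_1=\sigma_R\sigma_C\delta_{C,2}\|Rv\|_2\tfrac{L^2}{n\sqrt n}\big[u^{\top}v\,\delta_{R,C}(L+\mu)+\|u-\mathbf 1\|_2\|v-\mathbf 1\|_RL\big],$$ $$c_2=\sigma_R\sigma_C\delta_{C,2}\|u-\mathbf 1\|_2\|v-\mathbf 1\|_R\|R-I\|_2\tfrac{L^2}n+\sigma_C\delta_{C,2}\|Rv\|_2\|u-\mathbf 1\|_2(1-\sigma_R)\tfrac{L^2}n+\sigma_R\sigma_C\delta_{R,C}\delta_{C,2}L\|R-I\|_2\tfrac{u^{\top}v}n\mu+\sigma_R\|v-\mathbf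 1\|_R\tfrac{L^2}{\sqrt n}(1-\sigma_C)\tfrac{u^{\top}v}n,$$ $$c_3=\tfrac{u^{\top}v}{4n}\mu(1-\sigma_R)(1-\sigma_C).$$ Suppose that $\sigma_C>0$ and $c_2+\sqrt{c_2^2+4c_1c_3}>0$, and let the step size $\alpha>0$, with $\alpha':=\frac{\alpha}{n}u^{\top}v$, satisfy $$\alpha\le\min\Big\{\frac{2c_3}{c_2+\sqrt{c_2^2+4c_1c_3}},\ \frac{1-\sigma_C}{2\sigma_C\delta_{C,2}\|R\|_2L}\Big\},\qquad \alpha'\le\frac2{\mu+L}.$$ Let $\rho_A$ be the spectral radius of $$A=\begin{bmatrix}1-\alpha'\mu&\frac{\alpha'L}{\sqrt n}&\frac{\alpha\|u-\mathbf 1\|_2}n\\ \alpha\sigma_R\|v-\mathbf 1\|_RL&\sigma_R\big(1+\alpha\|v-\mathbf 1\|_R\frac L{\sqrt n}\big)&\alpha\sigma_R\delta_{R,C}\\ \alpha\sigma_C\delta_{C,2}\|Rv\|_2L^2&\sigma_C\delta_{C,2}L\big(\|R-I\|_2+\alpha\|Rv\|_2\frac L{\sqrt n}\big)&\sigma_C(1+\alpha\delta_{C,2}\|R\|_2L)\end{bmatrix}.$$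 Then $\rho_A<1$. Moreover, for every $\mathbf x_0\in\mathbb R^{n\times p}$, with $\nabla F(\mathbf x)$ the matrix whose $i$-th row is $\nabla f_i$ at the $i$-th row of $\mathbf x$, $\mathbf y_0=\nabla F(\mathbf x_0)$, $$\mathbf x_{k+1}=R(\mathbf x_k-\alpha\mathbf y_k),\qquad \mathbf y_{k+1}=C\big(\mathbf y_k+\nabla F(\mathbf x_{k+1})-\nabla F(\mathbf x_k)\big)\qquad(k\ge 0),$$ $\bar x_k=\frac1nu^{\top}\mathbf x_k$ and $\bar y_k=\frac1n\mathbf 1^{\top}\mathbf y_k$, the quantities $\|\bar x_k-x^*\|_2$, $\|\mathbf x_k-\mathbf 1\bar x_k\|_R$ and $\|\mathbf y_k-v\bar y_k\|_C$ all converge to $0$ and are $O(\rho_A^k)$ as $k\to\infty$. -/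

import Mathlib

open scoped Matrix

noncomputable section

namespace PushPull

/-! ### Norms on `ℝⁿ`, on `ℝⁿˣᵖ`, and induced matrix norms -/

/-- The Euclidean norm on `ℝⁿ`, as a seminorm on `Fin n → ℝ`. -/
def l2 (n : ℕ) : Seminorm ℝ (Fin n → ℝ) :=
  (normSeminorm ℝ (EuclideanSpace ℝ (Fin n))).comp
    (WithLp.linearEquiv 2 ℝ (Fin n → ℝ)).symm.toLinearMap

/-- The extension of a norm `N` on `ℝⁿ` to `n × p` matrices: the 2-norm of the vector of the
`N`-norms of the columns. -/
def matNorm {n p : ℕ} (N : Seminorm ℝ (Fin n → ℝ)) (X : Matrix (Fin n) (Fin p) ℝ) : ℝ :=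
  Real.sqrt (∑ j, N (fun i => X i j) ^ 2)

/-- The matrix norm induced by a norm `N` on `ℝⁿ`: the least `c ≥ 0` with `N (W x) ≤ c * N x`
for all `x`. -/
def inducedNorm {n : ℕ} (N : Seminorm ℝ (Fin n → ℝ)) (W : Matrix (Fin n) (Fin n) ℝ) : ℝ :=
  sInf {c : ℝ | 0 ≤ c ∧ ∀ x : Fin n → ℝ, N (W *ᵥ x) ≤ c * N x}

/-- The matrix norm `‖W‖₂` (operator norm for the Euclidean norm). -/
def opNorm2 {n : ℕ} (W : Matrix (Fin n) (Fin n) ℝ) : ℝ :=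
  ‖Matrix.toEuclideanCLM (n := Fin n) (𝕜 := ℝ) W‖

/-- The spectral radius of a real square matrix (largest modulus of a complex eigenvalue). -/
def specRadius {n : ℕ} (A : Matrix (Fin n) (Fin n) ℝ) : ENNReal :=
  spectralRadius ℂ (A.map (algebraMap ℝ ℂ))

/-! ### Graphs -/

/-- The directed graph induced by a matrix: there is an edge from `j` to `i` iff `M i j > 0`. -/
def inducedGraph {n : ℕ} (M : Matrix (Fin n) (Fin n) ℝ) : Digraph (Fin n) where
  Adj j i := 0 < M i j

/-- `T` is a directed tree with root `r` reaching every vertex: the root has no parent, every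
other vertex has exactly one parent, and every vertex is reached from the root. -/
structure IsSpanningTreeRootedAt {n : ℕ} (T : Digraph (Fin n)) (r : Fin n) : Prop where
  root_no_parent : ∀ j, ¬ T.Adj j r
  unique_parent : ∀ i, i ≠ r → ∃! j, T.Adj j i
  reach : ∀ i, Relation.ReflTransGen T.Adj r i

/-- The set of the roots of all directed spanning trees contained in the graph of `M`. -/
def rootSet {n : ℕ} (M : Matrix (Fin n) (Fin n) ℝ) : Set (Fin n) :=
  {r | ∃ T : Digraph (Fin n), T ≤ inducedGraph M ∧ IsSpanningTreeRootedAt T r}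

/-! ### Standing assumptions -/

/-- Each `f i` is differentiable and `μ`-strongly convex with `L`-Lipschitz gradient. -/
structure StronglyConvexSmooth {n p : ℕ} (f : Fin n → EuclideanSpace ℝ (Fin p) → ℝ)
    (μ L : ℝ) : Prop where
  differentiable : ∀ i, Differentiable ℝ (f i)
  strong : ∀ i x x', μ * ‖x - x'‖ ^ 2 ≤ inner ℝ (gradient (f i) x - gradient (f i) x') (x - x')
  lipschitz : ∀ i x x', ‖gradient (f i) x - gradient (f i) x'‖ ≤ L * ‖x - x'‖

/-- `R` is row-stochastic and `C` is column-stochastic, both are nonnegative with positive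
diagonals, and the graphs of `R` and `Cᵀ` have spanning trees with a common root. -/
structure MixingMatrices {n : ℕ} (R C : Matrix (Fin n) (Fin n) ℝ) : Prop where
  R_nonneg : ∀ i j, 0 ≤ R i j
  C_nonneg : ∀ i j, 0 ≤ C i j
  R_row : R *ᵥ 1 = 1
  C_col : 1 ᵥ* C = 1
  R_diag : ∀ i, 0 < R i i
  C_diag : ∀ i, 0 < C i i
  common_root : (rootSet R ∩ rootSet Cᵀ).Nonempty

/-- `x` minimizes `∑ i, f i`. -/
def IsOptimal {n p : ℕ} (f : Fin n → EuclideanSpace ℝ (Fin p) → ℝ)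
    (x : EuclideanSpace ℝ (Fin p)) : Prop :=
  IsMinOn (fun z => ∑ i, f i z) Set.univ x

/-- `u` is a nonnegative left eigenvector of `R` for the eigenvalue `1`, with `uᵀ 1 = n`. -/
structure IsLeftVec {n : ℕ} (R : Matrix (Fin n) (Fin n) ℝ) (u : Fin n → ℝ) : Prop where
  nonneg : ∀ i, 0 ≤ u i
  eigen : u ᵥ* R = u
  sum_eq : ∑ i, u i = n

/-- `v` is a nonnegative right eigenvector of `C` for the eigenvalue `1`, with `1ᵀ v = n`. -/
structure IsRightVec {n : ℕ} (C : Matrix (Fin n) (Fin n) ℝ) (v : Fin n → ℝ) : Prop where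
  nonneg : ∀ i, 0 ≤ v i
  eigen : C *ᵥ v = v
  sum_eq : ∑ i, v i = n

/-! ### The iteration -/

/-- The matrix `∇F(X)` whose `i`-th row is `∇ f i` at the `i`-th row of `X`. -/
def gradF {n p : ℕ} (f : Fin n → EuclideanSpace ℝ (Fin p) → ℝ)
    (X : Matrix (Fin n) (Fin p) ℝ) : Matrix (Fin n) (Fin p) ℝ :=
  Matrix.of fun i j => gradient (f i) (WithLp.toLp 2 (X i)) j

/-- The pair `(x_k, y_k)` of Push-Pull iterates with step size `α`, started at `X₀`. -/
def iter {n p : ℕ} (f : Fin n → EuclideanSpace ℝ (Fin p) → ℝ)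
    (R C : Matrix (Fin n) (Fin n) ℝ) (α : ℝ) (X₀ : Matrix (Fin n) (Fin p) ℝ) :
    ℕ → Matrix (Fin n) (Fin p) ℝ × Matrix (Fin n) (Fin p) ℝ
  | 0 => (X₀, gradF f X₀)
  | k + 1 =>
    let X := (iter f R C α X₀ k).1
    let Y := (iter f R C α X₀ k).2
    let X' := R * (X - α • Y)
    (X', C * (Y + gradF f X' - gradF f X))

/-- The weighted mean `wᵀ X / n` of the rows of `X`. -/
def rowMean {n p : ℕ} (w : Fin n → ℝ) (X : Matrix (Fin n) (Fin p) ℝ) :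
    EuclideanSpace ℝ (Fin p) :=
  WithLp.toLp 2 ((1 / (n : ℝ)) • (w ᵥ* X))

/-- The optimality error `‖x̄_k - x*‖₂`, where `x̄_k = uᵀ x_k / n`. -/
def optError {n p : ℕ} (u : Fin n → ℝ) (xs : EuclideanSpace ℝ (Fin p))
    (X : Matrix (Fin n) (Fin p) ℝ) : ℝ :=
  ‖rowMean u X - xs‖

/-- The consensus error `‖x_k - 1 x̄_k‖_R`. -/
def consError {n p : ℕ} (NR : Seminorm ℝ (Fin n → ℝ)) (u : Fin n → ℝ)
    (X : Matrix (Fin n) (Fin p) ℝ) : ℝ :=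
  matNorm NR (X - Matrix.vecMulVec 1 (rowMean u X))

/-- The gradient tracking error `‖y_k - v ȳ_k‖_C`, where `ȳ_k = 1ᵀ y_k / n`. -/
def trackError {n p : ℕ} (NC : Seminorm ℝ (Fin n → ℝ)) (v : Fin n → ℝ)
    (Y : Matrix (Fin n) (Fin p) ℝ) : ℝ :=
  matNorm NC (Y - Matrix.vecMulVec v (rowMean 1 Y))

/-! ### The constants -/

/-- `σ_R`, the induced norm of `R - 1 uᵀ / n`. -/
def sigmaR {n : ℕ} (R : Matrix (Fin n) (Fin n) ℝ) (u : Fin n → ℝ)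
    (NR : Seminorm ℝ (Fin n → ℝ)) : ℝ :=
  inducedNorm NR (R - (1 / (n : ℝ)) • Matrix.vecMulVec 1 u)

/-- `σ_C`, the induced norm of `C - v 1ᵀ / n`. -/
def sigmaC {n : ℕ} (C : Matrix (Fin n) (Fin n) ℝ) (v : Fin n → ℝ)
    (NC : Seminorm ℝ (Fin n → ℝ)) : ℝ :=
  inducedNorm NC (C - (1 / (n : ℝ)) • Matrix.vecMulVec v 1)

/-- The choice of the norms `‖·‖_R` and `‖·‖_C` on `ℝⁿ` and of the constants `δ_{R,C}` and
`δ_{C,2}`: both norms are contracted by the deviation matrices, both dominate the 2-norm, and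
the constants compare the norms (extended to `n × p` matrices). -/
structure AdmissibleNorms {n : ℕ} (p : ℕ) (R C : Matrix (Fin n) (Fin n) ℝ) (u v : Fin n → ℝ)
    (NR NC : Seminorm ℝ (Fin n → ℝ)) (δRC δC2 : ℝ) : Prop where
  definite_R : ∀ x, NR x = 0 → x = 0
  definite_C : ∀ x, NC x = 0 → x = 0
  sigmaR_lt_one : sigmaR R u NR < 1
  sigmaC_lt_one : sigmaC C v NC < 1
  l2_le_R : ∀ X : Matrix (Fin n) (Fin p) ℝ, matNorm (l2 n) X ≤ matNorm NR X
  l2_le_C : ∀ X : Matrix (Fin n) (Fin p) ℝ, matNorm (l2 n) X ≤ matNorm NC X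
  δRC_pos : 0 < δRC
  δC2_pos : 0 < δC2
  R_le_C : ∀ X : Matrix (Fin n) (Fin p) ℝ, matNorm NR X ≤ δRC * matNorm NC X
  C_le_l2 : ∀ X : Matrix (Fin n) (Fin p) ℝ, matNorm NC X ≤ δC2 * matNorm (l2 n) X

/-- The effective step size `α' = α uᵀv / n`. -/
def effStep {n : ℕ} (u v : Fin n → ℝ) (α : ℝ) : ℝ := α / n * (u ⬝ᵥ v)

/-- The transition matrix `A`. -/
def transitionMatrix {n : ℕ} (R C : Matrix (Fin n) (Fin n) ℝ) (u v : Fin n → ℝ)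
    (NR NC : Seminorm ℝ (Fin n → ℝ)) (δRC δC2 μ L α : ℝ) : Matrix (Fin 3) (Fin 3) ℝ :=
  let σR := sigmaR R u NR
  let σC := sigmaC C v NC
  let α' := effStep u v α
  !![1 - α' * μ,
      α' * L / √n,
      α * l2 n (u - 1) / n;
    α * σR * NR (v - 1) * L,
      σR * (1 + α * NR (v - 1) * (L / √n)),
      α * σR * δRC;
    α * σC * δC2 * l2 n (R *ᵥ v) * L ^ 2,
      σC * δC2 * L * (opNorm2 (R - 1) + α * l2 n (R *ᵥ v) * (L / √n)),
      σC * (1 + α * δC2 * opNorm2 R * L)]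

/-- The constant `c₁`. -/
def c₁ {n : ℕ} (R C : Matrix (Fin n) (Fin n) ℝ) (u v : Fin n → ℝ)
    (NR NC : Seminorm ℝ (Fin n → ℝ)) (δRC δC2 μ L : ℝ) : ℝ :=
  let σR := sigmaR R u NR
  let σC := sigmaC C v NC
  σR * σC * δC2 * l2 n (R *ᵥ v) * (L ^ 2 / (n * √n)) *
    ((u ⬝ᵥ v) * δRC * (L + μ) + l2 n (u - 1) * NR (v - 1) * L)

/-- The constant `c₂`. -/
def c₂ {n : ℕ} (R C : Matrix (Fin n) (Fin n) ℝ) (u v : Fin n → ℝ)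
    (NR NC : Seminorm ℝ (Fin n → ℝ)) (δRC δC2 μ L : ℝ) : ℝ :=
  let σR := sigmaR R u NR
  let σC := sigmaC C v NC
  σR * σC * δC2 * l2 n (u - 1) * NR (v - 1) * opNorm2 (R - 1) * (L ^ 2 / n)
    + σC * δC2 * l2 n (R *ᵥ v) * l2 n (u - 1) * (1 - σR) * (L ^ 2 / n)
    + σR * σC * δRC * δC2 * L * opNorm2 (R - 1) * ((u ⬝ᵥ v) / n) * μ
    + σR * NR (v - 1) * (L ^ 2 / √n) * (1 - σC) * ((u ⬝ᵥ v) / n)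

/-- The constant `c₃`. -/
def c₃ {n : ℕ} (R C : Matrix (Fin n) (Fin n) ℝ) (u v : Fin n → ℝ)
    (NR NC : Seminorm ℝ (Fin n → ℝ)) (μ : ℝ) : ℝ :=
  (u ⬝ᵥ v) / (4 * n) * μ * (1 - sigmaR R u NR) * (1 - sigmaC C v NC)

/-- The denominator `c₂ + √(c₂² + 4 c₁ c₃)` in the first step size bound. -/
def boundDenom {n : ℕ} (R C : Matrix (Fin n) (Fin n) ℝ) (u v : Fin n → ℝ)
    (NR NC : Seminorm ℝ (Fin n → ℝ)) (δRC δC2 μ L : ℝ) : ℝ :=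
  c₂ R C u v NR NC δRC δC2 μ L +
    √(c₂ R C u v NR NC δRC δC2 μ L ^ 2 +
      4 * c₁ R C u v NR NC δRC δC2 μ L * c₃ R C u v NR NC μ)

/-- The upper bound on the step size. -/
def stepBound {n : ℕ} (R C : Matrix (Fin n) (Fin n) ℝ) (u v : Fin n → ℝ)
    (NR NC : Seminorm ℝ (Fin n → ℝ)) (δRC δC2 μ L : ℝ) : ℝ :=
  min (2 * c₃ R C u v NR NC μ / boundDenom R C u v NR NC δRC δC2 μ L)
    ((1 - sigmaC C v NC) / (2 * sigmaC C v NC * δC2 * opNorm2 R * L))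

/-- `a` converges to `0` at the linear rate `O(ρ ^ k)`. -/
def LinearRate (a : ℕ → ℝ) (ρ : ℝ) : Prop :=
  Filter.Tendsto a Filter.atTop (nhds 0) ∧
    Asymptotics.IsBigO Filter.atTop a (fun k : ℕ => ρ ^ k)

end PushPull

end

open scoped Matrix

noncomputable section

namespace PushPull

/-! ### Elementary properties of the norms -/

/-! Collect the three errors (distance of the mean to the optimum, consensus, tracking) in a vector
`e k`. The proof shows `e (k + 1) ≤ A e k` entrywise for a nonnegative matrix `A`, then studies `A`
alone.

The inequalities rest on an invariant: since `C` is column-stochastic, the mean of the `y`-rows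
always equals the mean of the local gradients (`rowMean_iter`). Hence the weighted mean of the
`x`-rows performs a gradient step of length `α'` on the average objective, perturbed by the other
two errors; such a step contracts by `1 - α' μ` (`norm_gradient_step_le`, from cocoercivity).
Deviations from the means evolve through `R - 1uᵀ/n` and `C - v1ᵀ/n`, which contract in the chosen
norms; Lipschitz gradients bound the remaining terms.

Such norms exist because a rooted stochastic matrix with positive diagonal has a power with a
positive column. This power contracts the `ℓ¹`-norm of row vectors with sum zero, so powers of the
deviation matrix become small, and a norm summing over finitely many rescaled powers makes the
matrix itself a contraction.

For the spectral radius, the step size lies below the positive root of `c₁ α² + c₂ α = c₃`, which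
forces `det (1 - A) > 0`; with diagonal entries below `1` this yields spectral radius below `1`
(`specRadius_lt_one_of_det_pos`).

The sharp rate `ρ ^ k`, without a loss of `ε` or a polynomial factor, needs a Perron-type vector `w
≥ 0` with `A w ≤ ρ w` (`exists_mulVec_le_specRadius`). Irreducibility makes `w` positive, and then
`e k` stays below a multiple of `ρ ^ k w`. If `σ_R = 0`, the consensus row of `A` vanishes and only
the other two indices communicate, which still suffices (`linearRate_of_le_mulVec`). -/

theorem l2_apply {n : ℕ} (x : Fin n → ℝ) :
    l2 n x = ‖(WithLp.toLp 2 x : EuclideanSpace ℝ (Fin n))‖ := rfl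

theorem l2_eq_sqrt {n : ℕ} (x : Fin n → ℝ) : l2 n x = √(∑ i, x i ^ 2) := by
  simp [l2_apply, EuclideanSpace.norm_eq]

theorem l2_eq_zero {n : ℕ} {x : Fin n → ℝ} (h : l2 n x = 0) : x = 0 := by
  rw [l2_apply, norm_eq_zero] at h
  simpa using congrArg WithLp.ofLp h

theorem abs_dotProduct_le {n : ℕ} (x y : Fin n → ℝ) : |x ⬝ᵥ y| ≤ l2 n x * l2 n y := by
  have h := abs_real_inner_le_norm (WithLp.toLp 2 y : EuclideanSpace ℝ (Fin n)) (WithLp.toLp 2 x)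
  rw [mul_comm]
  simpa [l2_apply, EuclideanSpace.inner_eq_star_dotProduct] using h

theorem l2_mulVec_le {n : ℕ} (W : Matrix (Fin n) (Fin n) ℝ) (x : Fin n → ℝ) :
    l2 n (W *ᵥ x) ≤ opNorm2 W * l2 n x := by
  simpa [l2_apply, opNorm2, Matrix.toEuclideanCLM_toLp] using
    (Matrix.toEuclideanCLM (n := Fin n) (𝕜 := ℝ) W).le_opNorm (WithLp.toLp 2 x)

theorem opNorm2_nonneg {n : ℕ} (W : Matrix (Fin n) (Fin n) ℝ) : 0 ≤ opNorm2 W := norm_nonneg _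

theorem matNorm_eq {n p : ℕ} (N : Seminorm ℝ (Fin n → ℝ)) (X : Matrix (Fin n) (Fin p) ℝ) :
    matNorm N X = l2 p (fun j => N (fun i => X i j)) := by
  rw [l2_eq_sqrt, matNorm]

theorem matNorm_nonneg {n p : ℕ} (N : Seminorm ℝ (Fin n → ℝ)) (X : Matrix (Fin n) (Fin p) ℝ) :
    0 ≤ matNorm N X := Real.sqrt_nonneg _

theorem l2_mono {n : ℕ} {x y : Fin n → ℝ} (h : ∀ i, |x i| ≤ y i) : l2 n x ≤ l2 n y := by
  rw [l2_eq_sqrt, l2_eq_sqrt]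
  refine Real.sqrt_le_sqrt (Finset.sum_le_sum fun i _ => ?_)
  rw [← sq_abs (x i)]
  exact pow_le_pow_left₀ (abs_nonneg _) (h i) 2

theorem l2_const_mul {n : ℕ} {c : ℝ} (hc : 0 ≤ c) (x : Fin n → ℝ) :
    l2 n (fun i => c * x i) = c * l2 n x := by
  have h := map_smul_eq_mul (l2 n) c x
  rwa [Real.norm_of_nonneg hc] at h

theorem matNorm_le_of_col_le {n m p : ℕ} {N : Seminorm ℝ (Fin n → ℝ)}
    {N' : Seminorm ℝ (Fin m → ℝ)} {X : Matrix (Fin n) (Fin p) ℝ} {Y : Matrix (Fin m) (Fin p) ℝ}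
    {c : ℝ} (hc : 0 ≤ c) (h : ∀ j, N (fun i => X i j) ≤ c * N' (fun i => Y i j)) :
    matNorm N X ≤ c * matNorm N' Y := by
  rw [matNorm_eq, matNorm_eq, ← l2_const_mul hc]
  exact l2_mono fun j => by rw [abs_of_nonneg (apply_nonneg _ _)]; exact h j

theorem matNorm_add_le {n p : ℕ} (N : Seminorm ℝ (Fin n → ℝ)) (X Y : Matrix (Fin n) (Fin p) ℝ) :
    matNorm N (X + Y) ≤ matNorm N X + matNorm N Y := by
  simp only [matNorm_eq]
  refine le_trans (l2_mono fun j => ?_) (map_add_le_add (l2 p) _ _)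
  rw [abs_of_nonneg (apply_nonneg _ _)]
  exact map_add_le_add N (fun i => X i j) (fun i => Y i j)

theorem matNorm_smul {n p : ℕ} (N : Seminorm ℝ (Fin n → ℝ)) {c : ℝ} (hc : 0 ≤ c)
    (X : Matrix (Fin n) (Fin p) ℝ) : matNorm N (c • X) = c * matNorm N X := by
  simp only [matNorm_eq]
  rw [← l2_const_mul hc]
  congr 1
  funext j
  have h := map_smul_eq_mul N c (fun i => X i j)
  rwa [Real.norm_of_nonneg hc] at h

theorem matNorm_neg {n p : ℕ} (N : Seminorm ℝ (Fin n → ℝ)) (X : Matrix (Fin n) (Fin p) ℝ) :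
    matNorm N (-X) = matNorm N X := by
  simp only [matNorm_eq]
  congr 1
  funext j
  exact map_neg_eq_map N (fun i => X i j)

theorem matNorm_sub_le {n p : ℕ} (N : Seminorm ℝ (Fin n → ℝ)) (X Y : Matrix (Fin n) (Fin p) ℝ) :
    matNorm N (X - Y) ≤ matNorm N X + matNorm N Y := by
  rw [sub_eq_add_neg, ← matNorm_neg N Y]
  exact matNorm_add_le N X (-Y)

theorem matNorm_vecMulVec {n p : ℕ} (N : Seminorm ℝ (Fin n → ℝ)) (w : Fin n → ℝ)
    (z : Fin p → ℝ) : matNorm N (Matrix.vecMulVec w z) = N w * l2 p z := by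
  rw [matNorm_eq, ← l2_const_mul (apply_nonneg N w), l2_eq_sqrt, l2_eq_sqrt]
  congr 1
  refine Finset.sum_congr rfl fun j _ => ?_
  have : (fun i => Matrix.vecMulVec w z i j) = z j • w := by
    ext i; simp [Matrix.vecMulVec_apply, mul_comm]
  rw [this, map_smul_eq_mul, Real.norm_eq_abs, mul_pow, sq_abs]
  ring

theorem matNorm_mul_le {n p : ℕ} {N : Seminorm ℝ (Fin n → ℝ)} {W : Matrix (Fin n) (Fin n) ℝ}
    {c : ℝ} (hc : 0 ≤ c) (h : ∀ x, N (W *ᵥ x) ≤ c * N x) (X : Matrix (Fin n) (Fin p) ℝ) :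
    matNorm N (W * X) ≤ c * matNorm N X :=
  matNorm_le_of_col_le hc fun j => h fun i => X i j

theorem matNorm_l2_eq_rows {n p : ℕ} (X : Matrix (Fin n) (Fin p) ℝ) :
    matNorm (l2 n) X = √(∑ i, l2 p (X i) ^ 2) := by
  have h : ∀ {m : ℕ} (x : Fin m → ℝ), l2 m x ^ 2 = ∑ i, x i ^ 2 := fun x => by
    rw [l2_eq_sqrt, Real.sq_sqrt (Finset.sum_nonneg fun i _ => sq_nonneg _)]
  simp only [matNorm, h]
  rw [Finset.sum_comm]

theorem l2_vecMul_le {n p : ℕ} (w : Fin n → ℝ) (X : Matrix (Fin n) (Fin p) ℝ) :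
    l2 p (w ᵥ* X) ≤ l2 n w * matNorm (l2 n) X := by
  rw [matNorm_eq, ← l2_const_mul (apply_nonneg _ w)]
  exact l2_mono fun j => abs_dotProduct_le w fun i => X i j

theorem l2_one (n : ℕ) : l2 n 1 = √n := by
  simp [l2_eq_sqrt]

/-- A bound between the extensions of two norms to `n × p` matrices with `p > 0` restricts
to vectors. -/
theorem le_of_matNorm_le {n p : ℕ} (hp : 0 < p) {N N' : Seminorm ℝ (Fin n → ℝ)} {c : ℝ}
    (h : ∀ X : Matrix (Fin n) (Fin p) ℝ, matNorm N X ≤ c * matNorm N' X) (x : Fin n → ℝ) :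
    N x ≤ c * N' x := by
  -- All `p` columns equal `x`, so both sides acquire the same factor `√p`, nonzero because `p > 0`.
  have h1 := h (Matrix.vecMulVec x 1)
  rw [matNorm_vecMulVec, matNorm_vecMulVec, l2_one] at h1
  have : 0 < √(p : ℝ) := Real.sqrt_pos.2 (by exact_mod_cast hp)
  nlinarith

theorem inducedNorm_nonneg {n : ℕ} (N : Seminorm ℝ (Fin n → ℝ)) (W : Matrix (Fin n) (Fin n) ℝ) :
    0 ≤ inducedNorm N W :=
  Real.sInf_nonneg fun _ hc => hc.1

theorem inducedNorm_le {n : ℕ} {N : Seminorm ℝ (Fin n → ℝ)} {W : Matrix (Fin n) (Fin n) ℝ} {c : ℝ}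
    (hc : 0 ≤ c) (h : ∀ x, N (W *ᵥ x) ≤ c * N x) : inducedNorm N W ≤ c :=
  csInf_le ⟨0, fun _ hc => hc.1⟩ ⟨hc, h⟩

/-- For a norm that is equivalent to the Euclidean norm, the infimum in `inducedNorm` is
attained. -/
theorem apply_mulVec_le_inducedNorm {n : ℕ} {N : Seminorm ℝ (Fin n → ℝ)} {δ : ℝ} (hδ : 0 ≤ δ)
    (h1 : ∀ x, l2 n x ≤ N x) (h2 : ∀ x, N x ≤ δ * l2 n x) (W : Matrix (Fin n) (Fin n) ℝ)
    (x : Fin n → ℝ) : N (W *ᵥ x) ≤ inducedNorm N W * N x := by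
  have hne : {c : ℝ | 0 ≤ c ∧ ∀ x : Fin n → ℝ, N (W *ᵥ x) ≤ c * N x}.Nonempty := by
    refine ⟨δ * opNorm2 W, mul_nonneg hδ (opNorm2_nonneg W), fun x => ?_⟩
    calc N (W *ᵥ x) ≤ δ * l2 n (W *ᵥ x) := h2 _
      _ ≤ δ * (opNorm2 W * l2 n x) := by gcongr; exact l2_mulVec_le W x
      _ ≤ δ * (opNorm2 W * N x) := by gcongr; exacts [opNorm2_nonneg W, h1 x]
      _ = δ * opNorm2 W * N x := by ring
  rcases (apply_nonneg N x).eq_or_lt with hx | hx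
  · obtain ⟨c, -, hc⟩ := hne
    have := hc x
    rw [← hx, mul_zero] at this ⊢
    exact this
  · rw [← div_le_iff₀ hx]
    exact le_csInf hne fun c hc => (div_le_iff₀ hx).2 (hc.2 x)

/-! ### Row-stochastic matrices with a rooted graph -/

section Stochastic

variable {n : ℕ} {S : Matrix (Fin n) (Fin n) ℝ}

theorem pow_entry_nonneg (h0 : ∀ i j, 0 ≤ S i j) (k : ℕ) (i j : Fin n) : 0 ≤ (S ^ k) i j := by
  induction k generalizing i j with
  | zero => rw [pow_zero, Matrix.one_apply]; split_ifs <;> norm_num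
  | succ k ih =>
    rw [pow_succ', Matrix.mul_apply]
    exact Finset.sum_nonneg fun l _ => mul_nonneg (h0 i l) (ih l j)

theorem pow_mulVec_one (h1 : S *ᵥ 1 = 1) (k : ℕ) : S ^ k *ᵥ 1 = 1 := by
  induction k with
  | zero => simp
  | succ k ih => rw [pow_succ, ← Matrix.mulVec_mulVec, h1, ih]

theorem vecMul_pow_eq_self {d : Fin n → ℝ} (h : d ᵥ* S = d) (k : ℕ) : d ᵥ* S ^ k = d := by
  induction k with
  | zero => simp
  | succ k ih => rw [pow_succ', ← Matrix.vecMul_vecMul, h, ih]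

theorem pow_entry_pos_succ (h0 : ∀ i j, 0 ≤ S i j) {i l r : Fin n} {k : ℕ} (hil : 0 < S i l)
    (hk : 0 < (S ^ k) l r) : 0 < (S ^ (k + 1)) i r := by
  rw [pow_succ', Matrix.mul_apply]
  refine (mul_pos hil hk).trans_le ?_
  exact Finset.single_le_sum (f := fun l => S i l * (S ^ k) l r)
    (fun l _ => mul_nonneg (h0 i l) (pow_entry_nonneg h0 k l r)) (Finset.mem_univ l)

theorem pow_entry_pos_mono (h0 : ∀ i j, 0 ≤ S i j) (hd : ∀ i, 0 < S i i) {i r : Fin n} {k m : ℕ}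
    (hkm : k ≤ m) (hk : 0 < (S ^ k) i r) : 0 < (S ^ m) i r := by
  induction m, hkm using Nat.le_induction with
  | base => exact hk
  | succ m _ ih => exact pow_entry_pos_succ h0 (hd i) ih

/-- Some power of a nonnegative matrix with positive diagonal has a positive column at every root
of its graph. -/
theorem exists_pow_column_pos (h0 : ∀ i j, 0 ≤ S i j) (hd : ∀ i, 0 < S i i) {r : Fin n}
    (hr : r ∈ rootSet S) : ∃ k, ∀ i, 0 < (S ^ k) i r := by
  obtain ⟨T, hT, htree⟩ := hr
  have key : ∀ i, ∃ k, 0 < (S ^ k) i r := fun i => by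
    induction htree.reach i with
    | refl => exact ⟨0, by simp⟩
    | tail _ hab ih =>
      obtain ⟨k, hk⟩ := ih
      exact ⟨k + 1, pow_entry_pos_succ h0 (hT hab) hk⟩
  choose k hk using key
  -- The positive diagonal lets positivity persist to larger exponents, so one exponent serves all
  -- rows.
  exact ⟨Finset.univ.sup k, fun i =>
    pow_entry_pos_mono h0 hd (Finset.le_sup (Finset.mem_univ i)) (hk i)⟩

theorem row_sum_eq_one (h1 : S *ᵥ 1 = 1) (i : Fin n) : ∑ j, S i j = 1 := by
  simpa [Matrix.mulVec, dotProduct] using congrFun h1 i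

theorem sum_vecMul (h1 : S *ᵥ 1 = 1) (d : Fin n → ℝ) : ∑ j, (d ᵥ* S) j = ∑ i, d i := by
  have : (d ᵥ* S) ⬝ᵥ 1 = d ⬝ᵥ 1 := by rw [← Matrix.dotProduct_mulVec, h1]
  simpa [dotProduct] using this

/-- A row-stochastic matrix with a column bounded below by `ε` contracts the `ℓ¹`-norm of row
vectors with sum zero by the factor `1 - ε`. -/
theorem sum_abs_vecMul_le (h1 : S *ᵥ 1 = 1) {r : Fin n} {ε : ℝ}
    (h0 : ∀ i j, (if j = r then ε else 0) ≤ S i j) {d : Fin n → ℝ}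
    (hd : ∑ i, d i = 0) :
    ∑ j, |(d ᵥ* S) j| ≤ (1 - ε) * ∑ i, |d i| := by
  -- As `d` has sum zero, subtracting `ε` throughout column `r` does not change `d ᵥ* S`. The
  -- reduced matrix is still nonnegative, with row sums `1 - ε`.
  have hj : ∀ j, |(d ᵥ* S) j| ≤ ∑ i, |d i| * (S i j - if j = r then ε else 0) := fun j => by
    have : (d ᵥ* S) j = ∑ i, d i * (S i j - if j = r then ε else 0) := by
      simp only [mul_sub, Finset.sum_sub_distrib, ← Finset.sum_mul]
      simp [Matrix.vecMul, dotProduct, hd]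
    rw [this]
    refine (Finset.abs_sum_le_sum_abs _ _).trans (Finset.sum_le_sum fun i _ => ?_)
    rw [abs_mul, abs_of_nonneg (sub_nonneg.2 (h0 i j))]
  refine (Finset.sum_le_sum fun j _ => hj j).trans_eq ?_
  rw [Finset.sum_comm, Finset.mul_sum]
  refine Finset.sum_congr rfl fun i _ => ?_
  rw [← Finset.mul_sum, Finset.sum_sub_distrib, row_sum_eq_one h1]
  simp [mul_comm]

/-- The `ℓ¹`-contraction on sum-zero row vectors for some power of a rooted row-stochastic
matrix. -/
theorem exists_pow_contraction (h0 : ∀ i j, 0 ≤ S i j) (h1 : S *ᵥ 1 = 1) (hd : ∀ i, 0 < S i i)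
    {r : Fin n} (hr : r ∈ rootSet S) :
    ∃ (k : ℕ) (q : ℝ), 0 ≤ q ∧ q < 1 ∧ ∀ d : Fin n → ℝ, ∑ i, d i = 0 →
      ∑ j, |(d ᵥ* S ^ k) j| ≤ q * ∑ i, |d i| := by
  obtain ⟨k, hk⟩ := exists_pow_column_pos h0 hd hr
  have : Nonempty (Fin n) := ⟨r⟩
  obtain ⟨i₀, hi₀⟩ := Finite.exists_min fun i => (S ^ k) i r
  refine ⟨k, 1 - (S ^ k) i₀ r, ?_, by linarith [hk i₀], fun d hd0 => ?_⟩
  · have := Finset.single_le_sum (f := fun j => (S ^ k) i₀ j)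
      (fun j _ => pow_entry_nonneg h0 k i₀ j) (Finset.mem_univ r)
    rw [row_sum_eq_one (pow_mulVec_one h1 k)] at this
    linarith
  · refine sum_abs_vecMul_le (r := r) (pow_mulVec_one h1 k) (fun i j => ?_) hd0
    split_ifs with h
    · exact h ▸ hi₀ i
    · exact pow_entry_nonneg h0 k i j

/-- A row-stochastic matrix has a nonnegative left eigenvector for the eigenvalue `1`. -/
theorem exists_isLeftVec (hn : 0 < n) (h0 : ∀ i j, 0 ≤ S i j) (h1 : S *ᵥ 1 = 1) :
    ∃ u, IsLeftVec S u := by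
  have : Nonempty (Fin n) := ⟨⟨0, hn⟩⟩
  have hdet : (S - 1).det = 0 :=
    Matrix.exists_mulVec_eq_zero_iff.1 ⟨1, one_ne_zero, by rw [Matrix.sub_mulVec, h1]; simp⟩
  obtain ⟨d, hd0, hd⟩ := Matrix.exists_vecMul_eq_zero_iff.2 hdet
  rw [Matrix.vecMul_sub, Matrix.vecMul_one, sub_eq_zero] at hd
  set a : Fin n → ℝ := fun i => |d i| with ha
  -- The triangle inequality makes `|d|` subinvariant. Multiplication by `S` preserves the total
  -- sum, so every inequality is an equality.
  have hle : ∀ j, a j ≤ (a ᵥ* S) j := fun j => by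
    have hj : d j = ∑ i, d i * S i j := by rw [← congrFun hd j]; rfl
    calc a j = |∑ i, d i * S i j| := by rw [← hj]
      _ ≤ ∑ i, |d i * S i j| := Finset.abs_sum_le_sum_abs _ _
      _ = (a ᵥ* S) j := Finset.sum_congr rfl fun i _ => by rw [abs_mul, abs_of_nonneg (h0 i j)]
  have heq : a ᵥ* S = a := by
    have := (Finset.sum_eq_sum_iff_of_le fun j _ => hle j).1 (sum_vecMul h1 a).symm
    exact funext fun j => (this j (Finset.mem_univ j)).symm
  have hpos : 0 < ∑ i, a i := by
    obtain ⟨i, hi⟩ := Function.ne_iff.1 hd0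
    exact Finset.sum_pos' (fun i _ => abs_nonneg _) ⟨i, Finset.mem_univ i, abs_pos.2 hi⟩
  refine ⟨(n / ∑ i, a i) • a, fun i => ?_, ?_, ?_⟩
  · exact mul_nonneg (by positivity) (abs_nonneg _)
  · rw [Matrix.smul_vecMul, heq]
  · simp only [Pi.smul_apply, smul_eq_mul, ← Finset.mul_sum]
    field_simp

/-- The difference of two solutions has sum zero and is fixed by every power of `S`, while some
power strictly contracts it in `ℓ¹`. -/
theorem existsUnique_isLeftVec (h0 : ∀ i j, 0 ≤ S i j) (h1 : S *ᵥ 1 = 1) (hd : ∀ i, 0 < S i i)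
    {r : Fin n} (hr : r ∈ rootSet S) : ∃! u, IsLeftVec S u := by
  obtain ⟨u, hu⟩ := exists_isLeftVec r.pos h0 h1
  refine ⟨u, hu, fun w hw => ?_⟩
  obtain ⟨k, q, -, hq, hk⟩ := exists_pow_contraction h0 h1 hd hr
  have h := hk (w - u) (by simp [hu.sum_eq, hw.sum_eq])
  rw [Matrix.sub_vecMul, vecMul_pow_eq_self hu.eigen, vecMul_pow_eq_self hw.eigen] at h
  have hnn : 0 ≤ ∑ i, |(w - u) i| := Finset.sum_nonneg fun i _ => abs_nonneg _
  have hz : ∑ i, |(w - u) i| = 0 := by nlinarith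
  rw [Finset.sum_eq_zero_iff_of_nonneg fun i _ => abs_nonneg _] at hz
  exact funext fun i => sub_eq_zero.1 (abs_eq_zero.1 (hz i (Finset.mem_univ i)))

/-- The powers of `S - 1 wᵀ / n` have arbitrarily small entries. -/
theorem exists_pow_deviation_small (h0 : ∀ i j, 0 ≤ S i j) (h1 : S *ᵥ 1 = 1)
    (hd : ∀ i, 0 < S i i) {r : Fin n} (hr : r ∈ rootSet S) {w : Fin n → ℝ} (hw : IsLeftVec S w)
    {η : ℝ} (hη : 0 < η) :
    ∃ m, 0 < m ∧ ∀ i j,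
      |((S - (1 / (n : ℝ)) • Matrix.vecMulVec 1 w : Matrix (Fin n) (Fin n) ℝ) ^ m) i j| ≤ η := by
  set M : Matrix (Fin n) (Fin n) ℝ := S - (1 / (n : ℝ)) • Matrix.vecMulVec 1 w with hM
  have hn : (n : ℝ) ≠ 0 := by exact_mod_cast r.pos.ne'
  obtain ⟨k, q, hq0, hq, hk⟩ := exists_pow_contraction h0 h1 hd hr
  have hvec : ∀ d : Fin n → ℝ, d ᵥ* M = d ᵥ* S - ((1 / (n : ℝ)) * ∑ i, d i) • w := fun d => by
    rw [hM, Matrix.vecMul_sub, Matrix.vecMul_smul, Matrix.vecMul_vecMulVec, smul_smul]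
    simp [dotProduct]
  have hsum : ∀ d : Fin n → ℝ, ∑ j, (d ᵥ* M) j = 0 := fun d => by
    rw [hvec]
    simp only [Pi.sub_apply, Pi.smul_apply, smul_eq_mul, Finset.sum_sub_distrib, ← Finset.mul_sum,
      sum_vecMul h1, hw.sum_eq]
    field_simp
    ring
  -- `M` and `S` agree on row vectors with sum zero, and `M` sends every row vector to one with sum
  -- zero.
  have hpow : ∀ (m : ℕ) (d : Fin n → ℝ), ∑ i, d i = 0 → d ᵥ* M ^ m = d ᵥ* S ^ m := fun m => by
    induction m with
    | zero => simp
    | succ m ih =>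
      intro d hd
      rw [pow_succ', pow_succ', ← Matrix.vecMul_vecMul, ← Matrix.vecMul_vecMul, ih _ (hsum d),
        hvec, hd]
      simp
  have hiter : ∀ (m : ℕ) (d : Fin n → ℝ), ∑ i, d i = 0 →
      ∑ j, |(d ᵥ* S ^ (k * m)) j| ≤ q ^ m * ∑ i, |d i| := fun m => by
    induction m with
    | zero => simp
    | succ m ih =>
      intro d hd
      rw [mul_add, mul_one, pow_add, ← Matrix.vecMul_vecMul]
      refine (hk _ ?_).trans ?_
      · rw [sum_vecMul (pow_mulVec_one h1 _), hd]
      · rw [pow_succ', mul_assoc]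
        exact mul_le_mul_of_nonneg_left (ih d hd) hq0
  have hB : ∀ i, ∑ j, |M i j| ≤ ∑ i, ∑ j, |M i j| := fun i =>
    Finset.single_le_sum (f := fun i => ∑ j, |M i j|)
      (fun i _ => Finset.sum_nonneg fun j _ => abs_nonneg _) (Finset.mem_univ i)
  set B := ∑ i, ∑ j, |M i j|
  have hB0 : 0 ≤ B := Finset.sum_nonneg fun i _ => Finset.sum_nonneg fun j _ => abs_nonneg _
  obtain ⟨m, hm⟩ := exists_pow_lt_of_lt_one (show 0 < η / (B + 1) by positivity) hq
  -- The extra factor moves the basis row into the sum-zero space; the remaining `k * m` factors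
  -- then contract by `q ^ m`.
  refine ⟨k * m + 1, by omega, fun i j => ?_⟩
  have hrow : (M ^ (k * m + 1)) i = (Pi.single i 1 ᵥ* M) ᵥ* S ^ (k * m) := by
    rw [← hpow _ _ (hsum _), Matrix.vecMul_vecMul, ← pow_succ', Matrix.single_one_vecMul]
    rfl
  rw [hrow]
  calc |((Pi.single i 1 ᵥ* M) ᵥ* S ^ (k * m)) j|
      ≤ ∑ j, |((Pi.single i 1 ᵥ* M) ᵥ* S ^ (k * m)) j| :=
        Finset.single_le_sum (f := fun j => |((Pi.single i 1 ᵥ* M) ᵥ* S ^ (k * m)) j|)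
          (fun j _ => abs_nonneg _) (Finset.mem_univ j)
    _ ≤ q ^ m * ∑ j, |(Pi.single i 1 ᵥ* M) j| := hiter m _ (hsum _)
    _ ≤ q ^ m * B := by
        rw [Matrix.single_one_vecMul]
        exact mul_le_mul_of_nonneg_left (hB i) (pow_nonneg hq0 m)
    _ ≤ η / (B + 1) * B := mul_le_mul_of_nonneg_right hm.le hB0
    _ ≤ η := by
        rw [div_mul_eq_mul_div, div_le_iff₀ (by positivity)]
        nlinarith

end Stochastic

/-! ### Norms contracted by a matrix with small powers -/

/-- One factor `n` in the entry bound pays for summing a row, the other for passing from entries to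
the Euclidean norm, which costs only `√n ≤ n`. -/
theorem l2_mulVec_le_half {n : ℕ} (hn : 0 < n) {W : Matrix (Fin n) (Fin n) ℝ}
    (hW : ∀ i j, |W i j| ≤ 1 / (2 * (n : ℝ) ^ 2)) (x : Fin n → ℝ) :
    l2 n (W *ᵥ x) ≤ 1 / 2 * l2 n x := by
  have hn' : (1 : ℝ) ≤ n := by exact_mod_cast hn
  have hx : ∀ j, |x j| ≤ l2 n x := fun j => by
    rw [l2_apply]
    exact PiLp.norm_apply_le (WithLp.toLp 2 x : EuclideanSpace ℝ (Fin n)) j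
  have h : ∀ i, |(W *ᵥ x) i| ≤ 1 / (2 * n) * l2 n x * 1 := fun i => by
    calc |(W *ᵥ x) i| ≤ ∑ j, |W i j * x j| :=
          Finset.abs_sum_le_sum_abs (fun j => W i j * x j) Finset.univ
      _ ≤ ∑ _j : Fin n, 1 / (2 * (n : ℝ) ^ 2) * l2 n x := Finset.sum_le_sum fun j _ => by
          rw [abs_mul]
          exact mul_le_mul (hW i j) (hx j) (abs_nonneg _) (by positivity)
      _ = 1 / (2 * n) * l2 n x * 1 := by
          simp only [Finset.sum_const, Finset.card_univ, Fintype.card_fin, nsmul_eq_mul]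
          field_simp
  have h1 : √(n : ℝ) ≤ n := Real.sqrt_le_iff.2 ⟨by linarith, by nlinarith⟩
  have hl := apply_nonneg (l2 n) x
  calc l2 n (W *ᵥ x) ≤ l2 n (fun i => 1 / (2 * n) * l2 n x * (1 : Fin n → ℝ) i) := l2_mono h
    _ = 1 / (2 * n) * l2 n x * √n := by rw [l2_const_mul (by positivity), l2_one]
    _ ≤ 1 / (2 * n) * l2 n x * n := by gcongr
    _ = 1 / 2 * l2 n x := by field_simp

/-- If some power of `M` halves the Euclidean norm, then `M` is a contraction for a norm that
dominates the Euclidean norm and is equivalent to it. -/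
theorem exists_contracted_norm {n : ℕ} {M : Matrix (Fin n) (Fin n) ℝ} {m : ℕ} (hm : 0 < m)
    (h : ∀ x, l2 n (M ^ m *ᵥ x) ≤ 1 / 2 * l2 n x) :
    ∃ (N : Seminorm ℝ (Fin n → ℝ)) (δ : ℝ), 0 < δ ∧ (∀ x, l2 n x ≤ N x) ∧
      (∀ x, N x ≤ δ * l2 n x) ∧ inducedNorm N M < 1 := by
  -- With this `c`, the rescaled matrix `B = c⁻¹ M` satisfies `‖B ^ m x‖ ≤ ‖x‖`. For `N x = ∑ ‖B ^ k
  -- x‖` over `k < m`, replacing `x` by `B x` trades the term `k = 0` for the term `k = m`, so `N`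
  -- does not increase under `B`, and `M = c B` contracts by `c`.
  set c : ℝ := (1 / 2 : ℝ) ^ ((m : ℝ)⁻¹) with hc
  have hc0 : 0 < c := by positivity
  have hc1 : c < 1 := Real.rpow_lt_one (by norm_num) (by norm_num) (by positivity)
  have hcm : c ^ m = 1 / 2 := Real.rpow_inv_natCast_pow (by norm_num) hm.ne'
  set B : Matrix (Fin n) (Fin n) ℝ := c⁻¹ • M with hB
  have hBm : ∀ x, l2 n (B ^ m *ᵥ x) ≤ l2 n x := fun x => by
    rw [hB, smul_pow, inv_pow, hcm, Matrix.smul_mulVec, map_smul_eq_mul]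
    have := h x
    norm_num
    linarith
  set N : Seminorm ℝ (Fin n → ℝ) :=
    ∑ k ∈ Finset.range m, (l2 n).comp (Matrix.toLin' (B ^ k)) with hN
  have hNx : ∀ x, N x = ∑ k ∈ Finset.range m, l2 n (B ^ k *ᵥ x) := fun x => by
    
    simp [hN, -Matrix.toLin'_pow]
  have hMB : M = c • B := by rw [hB, smul_smul, mul_inv_cancel₀ hc0.ne', one_smul]
  refine ⟨N, ∑ k ∈ Finset.range m, opNorm2 (B ^ k) + 1, ?_, fun x => ?_, fun x => ?_, ?_⟩
  · have := Finset.sum_nonneg fun k (_ : k ∈ Finset.range m) => opNorm2_nonneg (B ^ k)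
    linarith
  · rw [hNx]
    simpa using Finset.single_le_sum (f := fun k => l2 n (B ^ k *ᵥ x))
      (fun k _ => apply_nonneg _ _) (Finset.mem_range.2 hm)
  · rw [hNx, add_mul, Finset.sum_mul, one_mul]
    exact (Finset.sum_le_sum fun k _ => l2_mulVec_le (B ^ k) x).trans
      (le_add_of_nonneg_right (apply_nonneg _ _))
  · refine (inducedNorm_le hc0.le fun x => ?_).trans_lt hc1
    rw [hMB, Matrix.smul_mulVec, map_smul_eq_mul, Real.norm_of_nonneg hc0.le]
    refine mul_le_mul_of_nonneg_left ?_ hc0.le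
    have e := Finset.sum_range_succ' (fun k => l2 n (B ^ k *ᵥ x)) m
    rw [Finset.sum_range_succ] at e
    simp only [hNx, Matrix.mulVec_mulVec, ← pow_succ]
    have := hBm x
    simp only [pow_zero, Matrix.one_mulVec] at e
    linarith

theorem IsRightVec.transpose {n : ℕ} {C : Matrix (Fin n) (Fin n) ℝ} {v : Fin n → ℝ} :
    IsRightVec C v ↔ IsLeftVec Cᵀ v :=
  ⟨fun h => ⟨h.nonneg, by rw [Matrix.vecMul_transpose]; exact h.eigen, h.sum_eq⟩,
    fun h => ⟨h.nonneg, by rw [← Matrix.vecMul_transpose]; exact h.eigen, h.sum_eq⟩⟩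

theorem matNorm_mono {n p : ℕ} {N N' : Seminorm ℝ (Fin n → ℝ)} {c : ℝ} (hc : 0 ≤ c)
    (h : ∀ x, N x ≤ c * N' x) (X : Matrix (Fin n) (Fin p) ℝ) :
    matNorm N X ≤ c * matNorm N' X :=
  matNorm_le_of_col_le hc fun _ => h _

theorem exists_admissibleNorms {n : ℕ} (p : ℕ) {R C : Matrix (Fin n) (Fin n) ℝ}
    (hRC : MixingMatrices R C) {u v : Fin n → ℝ} (hu : IsLeftVec R u) (hv : IsRightVec C v) :
    ∃ (NR NC : Seminorm ℝ (Fin n → ℝ)) (δRC δC2 : ℝ),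
      AdmissibleNorms p R C u v NR NC δRC δC2 := by
  obtain ⟨r, hrR, hrC⟩ := hRC.common_root
  have hn : 0 < n := r.pos
  have hη : (0 : ℝ) < 1 / (2 * (n : ℝ) ^ 2) := by positivity
  obtain ⟨m, hm, hsmall⟩ :=
    exists_pow_deviation_small hRC.R_nonneg hRC.R_row hRC.R_diag hrR hu hη
  obtain ⟨m', hm', hsmall'⟩ := exists_pow_deviation_small (S := Cᵀ) (fun i j => hRC.C_nonneg j i)
    (by rw [Matrix.mulVec_transpose]; exact hRC.C_col) hRC.C_diag hrC
    (IsRightVec.transpose.1 hv) hη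
  have htr : Cᵀ - (1 / (n : ℝ)) • Matrix.vecMulVec 1 v =
      (C - (1 / (n : ℝ)) • Matrix.vecMulVec v 1)ᵀ := by
    rw [Matrix.transpose_sub, Matrix.transpose_smul, Matrix.transpose_vecMulVec]
  rw [htr, ← Matrix.transpose_pow] at hsmall'
  obtain ⟨NR, δR, hδR, hR1, hR2, hσR⟩ := exists_contracted_norm hm (l2_mulVec_le_half hn hsmall)
  obtain ⟨NC, δC, hδC, hC1, hC2, hσC⟩ :=
    exists_contracted_norm hm' (l2_mulVec_le_half hn fun i j => hsmall' j i)
  -- `δR` also serves for the comparison with `NC`, because `NR ≤ δR * l2 ≤ δR * NC`.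
  refine ⟨NR, NC, δR, δC, ?_, ?_, hσR, hσC, ?_, ?_, hδR, hδC, ?_, ?_⟩
  · exact fun x hx => l2_eq_zero (le_antisymm (hx ▸ hR1 x) (apply_nonneg _ _))
  · exact fun x hx => l2_eq_zero (le_antisymm (hx ▸ hC1 x) (apply_nonneg _ _))
  · exact fun X => by simpa using matNorm_mono zero_le_one (by simpa using hR1) X
  · exact fun X => by simpa using matNorm_mono zero_le_one (by simpa using hC1) X
  · exact matNorm_mono hδR.le fun x =>
      (hR2 x).trans (mul_le_mul_of_nonneg_left (hC1 x) hδR.le)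
  · exact matNorm_mono hδC.le hC2

/-! ### Strongly convex functions with Lipschitz gradient -/

section Gradient

open Set

variable {E : Type*} [NormedAddCommGroup E] [InnerProductSpace ℝ E] [CompleteSpace E]
  {h : E → ℝ} {G : E → E}

/-- On the segment from `x` to `y`, the difference between `h` and its quadratic model has
nonpositive derivative. Neither convexity nor a sign of `ℓ` is needed. -/
theorem le_quadratic_of_inner_le (hG : ∀ x, HasGradientAt h (G x) x) {ℓ : ℝ}
    (hup : ∀ x y, inner ℝ (G x - G y) (x - y) ≤ ℓ * ‖x - y‖ ^ 2) (x y : E) :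
    h y ≤ h x + inner ℝ (G x) (y - x) + ℓ / 2 * ‖y - x‖ ^ 2 := by
  set d := y - x with hd
  have hder : ∀ t : ℝ, HasDerivAt
      (fun t : ℝ => h (x + t • d) - t * inner ℝ (G x) d - ℓ / 2 * t ^ 2 * ‖d‖ ^ 2)
      (inner ℝ (G (x + t • d)) d - inner ℝ (G x) d - ℓ * t * ‖d‖ ^ 2) t := fun t => by
    have h1 : HasDerivAt (fun t : ℝ => x + t • d) d t := by
      simpa using ((hasDerivAt_id t).smul_const d).const_add x
    have h2 := (hG (x + t • d)).hasFDerivAt.comp_hasDerivAt t h1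
    have h3 : HasDerivAt (fun t : ℝ => t * inner ℝ (G x) d) (inner ℝ (G x) d) t := by
      simpa using (hasDerivAt_id t).mul_const (inner ℝ (G x) d)
    have h4 : HasDerivAt (fun t : ℝ => ℓ / 2 * t ^ 2 * ‖d‖ ^ 2) (ℓ * t * ‖d‖ ^ 2) t := by
      refine (((hasDerivAt_pow 2 t).const_mul (ℓ / 2)).mul_const (‖d‖ ^ 2)).congr_deriv ?_
      norm_num
      left
      ring
    exact (h2.sub h3).sub h4
  have hanti := antitoneOn_of_deriv_nonpos (convex_Icc (0 : ℝ) 1)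
    (fun t _ => (hder t).continuousAt.continuousWithinAt)
    (fun t _ => (hder t).differentiableAt.differentiableWithinAt) (fun t ht => ?_)
  · have := hanti (left_mem_Icc.2 zero_le_one) (right_mem_Icc.2 zero_le_one) zero_le_one
    simp only [one_smul, zero_smul, add_zero] at this
    rw [hd, add_sub_cancel, ← hd] at this
    linarith
  · rw [(hder t).deriv]
    rw [interior_Icc] at ht
    have := hup (x + t • d) x
    rw [add_sub_cancel_left, inner_smul_right, norm_smul, mul_pow, inner_sub_left,
      Real.norm_eq_abs, sq_abs] at this
    have ht0 := ht.1
    by_contra! hcon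
    nlinarith [mul_pos ht0 hcon]

/-- This is the upper bound for `-h` with `ℓ = -m`. -/
theorem quadratic_le_of_le_inner (hG : ∀ x, HasGradientAt h (G x) x) {m : ℝ}
    (hlo : ∀ x y, m * ‖x - y‖ ^ 2 ≤ inner ℝ (G x - G y) (x - y)) (x y : E) :
    h x + inner ℝ (G x) (y - x) + m / 2 * ‖y - x‖ ^ 2 ≤ h y := by
  have hG' : ∀ x, HasGradientAt (fun z => -h z) (-G x) x := fun x => by
    rw [hasGradientAt_iff_hasFDerivAt, map_neg]
    exact (hG x).hasFDerivAt.neg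
  have := le_quadratic_of_inner_le hG' (ℓ := -m) (fun x y => ?_) x y
  · rw [inner_neg_left] at this
    linarith
  · rw [neg_sub_neg, ← neg_sub (G x), inner_neg_left]
    linarith [hlo x y]

/-- Cocoercivity of the gradient of a smooth convex function. -/
theorem norm_sq_gradient_sub_le (hG : ∀ x, HasGradientAt h (G x) x) {ℓ : ℝ} (hℓ : 0 ≤ ℓ)
    (hlo : ∀ x y, 0 ≤ inner ℝ (G x - G y) (x - y))
    (hup : ∀ x y, inner ℝ (G x - G y) (x - y) ≤ ℓ * ‖x - y‖ ^ 2) (x y : E) :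
    ‖G x - G y‖ ^ 2 ≤ ℓ * inner ℝ (G x - G y) (x - y) := by
  -- Compare, at the point `x - l⁻¹ g` minimizing a quadratic model of slope `g = G x - G y`, the
  -- quadratic upper bound from `x` with the tangent lower bound from `y`. Adding the result to its
  -- mirror image in `x` and `y` gives cocoercivity.
  have key : ∀ l : ℝ, 0 < l → (∀ x y, inner ℝ (G x - G y) (x - y) ≤ l * ‖x - y‖ ^ 2) →
      ∀ x y, h y + inner ℝ (G y) (x - y) + l⁻¹ / 2 * ‖G x - G y‖ ^ 2 ≤ h x := by
    intro l hl hup x y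
    set g := G x - G y with hg
    have h1 := le_quadratic_of_inner_le hG hup x (x - l⁻¹ • g)
    have h2 := quadratic_le_of_le_inner hG (m := 0) (by simpa using hlo) y (x - l⁻¹ • g)
    have e1 : x - l⁻¹ • g - x = -(l⁻¹ • g) := by abel
    have e2 : x - l⁻¹ • g - y = (x - y) - l⁻¹ • g := by abel
    rw [e1, inner_neg_right, inner_smul_right, norm_neg, norm_smul, mul_pow,
      Real.norm_eq_abs, sq_abs] at h1
    rw [e2, inner_sub_right, inner_smul_right] at h2
    have e3 : inner ℝ (G x) g - inner ℝ (G y) g = ‖g‖ ^ 2 := by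
      rw [← inner_sub_left, ← hg, real_inner_self_eq_norm_sq]
    have e4 : l / 2 * (l⁻¹ ^ 2 * ‖g‖ ^ 2) = l⁻¹ / 2 * ‖g‖ ^ 2 := by field_simp
    have e5 : l⁻¹ * inner ℝ (G x) g - l⁻¹ * inner ℝ (G y) g = l⁻¹ * ‖g‖ ^ 2 := by
      rw [← mul_sub, e3]
    linarith
  -- The constant `ℓ` may be zero (later, when `μ = L`), so the bound is proved for `l > ℓ` and
  -- passed to the limit.
  have hpos : ∀ l : ℝ, ℓ < l → ‖G x - G y‖ ^ 2 ≤ l * inner ℝ (G x - G y) (x - y) := by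
    intro l hl
    have hl0 : 0 < l := hℓ.trans_lt hl
    have hup' : ∀ x y, inner ℝ (G x - G y) (x - y) ≤ l * ‖x - y‖ ^ 2 := fun x y =>
      (hup x y).trans (mul_le_mul_of_nonneg_right hl.le (sq_nonneg _))
    have h1 := key l hl0 hup' x y
    have h2 := key l hl0 hup' y x
    rw [norm_sub_rev (G y), ← neg_sub x y, inner_neg_right] at h2
    have h3 : l⁻¹ * ‖G x - G y‖ ^ 2 ≤ inner ℝ (G x - G y) (x - y) := by
      rw [inner_sub_left]; linarith
    rwa [inv_mul_le_iff₀ hl0] at h3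
  have hc : Filter.Tendsto (fun l : ℝ => l * inner ℝ (G x - G y) (x - y)) (nhdsWithin ℓ (Ioi ℓ))
      (nhds (ℓ * inner ℝ (G x - G y) (x - y))) :=
    ((continuous_id.mul continuous_const).tendsto ℓ).mono_left nhdsWithin_le_nhds
  exact ge_of_tendsto hc (by filter_upwards [self_mem_nhdsWithin] with l hl using hpos l hl)

/-- A gradient step with step size `t ≤ 2 / (μ + L)` is a contraction with factor `1 - t μ`. -/
theorem norm_gradient_step_le (hG : ∀ x, HasGradientAt h (G x) x) {μ L t : ℝ} (hμ : 0 < μ)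
    (hμL : μ ≤ L) (hstrong : ∀ x y, μ * ‖x - y‖ ^ 2 ≤ inner ℝ (G x - G y) (x - y))
    (hlip : ∀ x y, ‖G x - G y‖ ≤ L * ‖x - y‖) (ht0 : 0 ≤ t) (ht : t ≤ 2 / (μ + L)) (x y : E) :
    ‖x - y - t • (G x - G y)‖ ≤ (1 - t * μ) * ‖x - y‖ := by
  have htL : t * (μ + L) ≤ 2 := (le_div_iff₀ (by linarith)).1 ht
  have h1t : 0 ≤ 1 - t * μ := by nlinarith
  -- Removing the quadratic part leaves a convex function of smoothness `L - μ`. Its cocoercivity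
  -- absorbs the term `t² ‖q‖²` into the cross term exactly when `t (μ + L) ≤ 2`.
  have hG' : ∀ x, HasGradientAt (fun z => h z - μ / 2 * ‖z‖ ^ 2) (G x - μ • x) x := fun x => by
    rw [hasGradientAt_iff_hasFDerivAt]
    refine ((hG x).hasFDerivAt.sub
      ((hasStrictFDerivAt_norm_sq x).hasFDerivAt.const_mul (μ / 2))).congr_fderiv ?_
    ext z
    simp
    ring
  have hsub : ∀ x y, (G x - μ • x) - (G y - μ • y) = (G x - G y) - μ • (x - y) := fun x y => by
    rw [smul_sub]; abel
  have hinner : ∀ x y, inner ℝ ((G x - μ • x) - (G y - μ • y)) (x - y) =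
      inner ℝ (G x - G y) (x - y) - μ * ‖x - y‖ ^ 2 := fun x y => by
    rw [hsub, inner_sub_left, real_inner_smul_left, real_inner_self_eq_norm_sq]
  have hco := norm_sq_gradient_sub_le hG' (ℓ := L - μ) (sub_nonneg.2 hμL)
    (fun x y => by rw [hinner]; linarith [hstrong x y])
    (fun x y => by
      rw [hinner]
      have h1 := real_inner_le_norm (G x - G y) (x - y)
      have h2 := mul_le_mul_of_nonneg_right (hlip x y) (norm_nonneg (x - y))
      nlinarith) x y
  have hq0 : 0 ≤ inner ℝ ((G x - μ • x) - (G y - μ • y)) (x - y) := by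
    rw [hinner]; linarith [hstrong x y]
  rw [hsub] at hco hq0
  set q := (G x - G y) - μ • (x - y) with hq
  have hstep : x - y - t • (G x - G y) = (1 - t * μ) • (x - y) - t • q := by
    rw [hq]; module
  refine abs_le_of_sq_le_sq' ?_ (mul_nonneg h1t (norm_nonneg _)) |>.2
  rw [hstep, norm_sub_sq_real, norm_smul, norm_smul, real_inner_smul_left, real_inner_smul_right,
    real_inner_comm, Real.norm_of_nonneg h1t, Real.norm_of_nonneg ht0]
  have h1 : t ^ 2 * ‖q‖ ^ 2 ≤ t ^ 2 * ((L - μ) * inner ℝ q (x - y)) :=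
    mul_le_mul_of_nonneg_left hco (sq_nonneg t)
  have h2 : 0 ≤ t * inner ℝ q (x - y) * (2 - t * (μ + L)) :=
    mul_nonneg (mul_nonneg ht0 hq0) (by linarith)
  nlinarith

theorem gradient_eq_zero_of_isMinOn (hG : ∀ x, HasGradientAt h (G x) x) {x : E}
    (hx : IsMinOn h univ x) : G x = 0 := by
  have := (hx.isLocalMin Filter.univ_mem).hasFDerivAt_eq_zero (hG x).hasFDerivAt
  simpa using this

/-- Existence comes from Banach's fixed point theorem: a fixed point of a gradient step is a zero of
the gradient, hence a minimizer by the quadratic lower bound. Strong monotonicity gives uniqueness.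
-/
theorem existsUnique_isMinOn (hG : ∀ x, HasGradientAt h (G x) x) {μ L : ℝ} (hμ : 0 < μ)
    (hμL : μ ≤ L) (hstrong : ∀ x y, μ * ‖x - y‖ ^ 2 ≤ inner ℝ (G x - G y) (x - y))
    (hlip : ∀ x y, ‖G x - G y‖ ≤ L * ‖x - y‖) : ∃! x, IsMinOn h univ x := by
  have hμL' : 0 < μ + L := by linarith
  have ht : (0 : ℝ) < 1 / (μ + L) := by positivity
  have hK : 0 ≤ 1 - 1 / (μ + L) * μ := by
    rw [sub_nonneg, one_div_mul_eq_div, div_le_one hμL']; linarith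
  have hK1 : 1 - 1 / (μ + L) * μ < 1 := by linarith [mul_pos ht hμ]
  have hcontr : ContractingWith ⟨1 - 1 / (μ + L) * μ, hK⟩ (fun x => x - (1 / (μ + L)) • G x) := by
    refine ⟨hK1, LipschitzWith.of_dist_le_mul fun x y => ?_⟩
    rw [dist_eq_norm, dist_eq_norm]
    have := norm_gradient_step_le hG hμ hμL hstrong hlip ht.le
      (by gcongr; norm_num) x y
    have e : x - (1 / (μ + L)) • G x - (y - (1 / (μ + L)) • G y) =
        x - y - (1 / (μ + L)) • (G x - G y) := by rw [smul_sub]; abel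
    rw [e]
    exact this
  have hzero : G (ContractingWith.fixedPoint _ hcontr) = 0 := by
    have := hcontr.fixedPoint_isFixedPt
    simpa [Function.IsFixedPt, ht.ne', hμL'.ne'] using this
  refine ⟨ContractingWith.fixedPoint _ hcontr, fun y _ => ?_, fun y hy => ?_⟩
  · have := quadratic_le_of_le_inner hG hstrong (ContractingWith.fixedPoint _ hcontr) y
    rw [hzero, inner_zero_left] at this
    have h2 : 0 ≤ μ / 2 * ‖y - ContractingWith.fixedPoint _ hcontr‖ ^ 2 := by positivity
    simp only [mem_ofPred_eq]
    linarith
  · have := hstrong y (ContractingWith.fixedPoint _ hcontr)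
    rw [hzero, gradient_eq_zero_of_isMinOn hG hy, sub_zero, inner_zero_left] at this
    have h2 : ‖y - ContractingWith.fixedPoint _ hcontr‖ ^ 2 = 0 :=
      le_antisymm (by nlinarith) (sq_nonneg _)
    exact sub_eq_zero.1 (norm_eq_zero.1 (pow_eq_zero_iff two_ne_zero |>.1 h2))

end Gradient

/-! ### The sum of the local objectives and its minimizer -/

section Objective

variable {n p : ℕ} {f : Fin n → EuclideanSpace ℝ (Fin p) → ℝ} {μ L : ℝ}

theorem StronglyConvexSmooth.hasGradientAt_sum (hf : StronglyConvexSmooth f μ L)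
    (x : EuclideanSpace ℝ (Fin p)) :
    HasGradientAt (fun z => ∑ i, f i z) (∑ i, gradient (f i) x) x := by
  rw [hasGradientAt_iff_hasFDerivAt, map_sum]
  exact HasFDerivAt.fun_sum fun i _ => (hf.differentiable i x).hasGradientAt.hasFDerivAt

theorem StronglyConvexSmooth.le_inner_sum (hf : StronglyConvexSmooth f μ L)
    (x y : EuclideanSpace ℝ (Fin p)) : (n * μ) * ‖x - y‖ ^ 2 ≤
      inner ℝ (∑ i, gradient (f i) x - ∑ i, gradient (f i) y) (x - y) := by
  rw [← Finset.sum_sub_distrib, sum_inner]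
  calc (n * μ) * ‖x - y‖ ^ 2 = ∑ _i : Fin n, μ * ‖x - y‖ ^ 2 := by simp; ring
    _ ≤ _ := Finset.sum_le_sum fun i _ => hf.strong i x y

theorem StronglyConvexSmooth.norm_sum_sub_le (hf : StronglyConvexSmooth f μ L)
    (x y : EuclideanSpace ℝ (Fin p)) :
    ‖∑ i, gradient (f i) x - ∑ i, gradient (f i) y‖ ≤ (n * L) * ‖x - y‖ := by
  rw [← Finset.sum_sub_distrib]
  calc _ ≤ ∑ i, ‖gradient (f i) x - gradient (f i) y‖ := norm_sum_le _ _
    _ ≤ ∑ _i : Fin n, L * ‖x - y‖ := Finset.sum_le_sum fun i _ => hf.lipschitz i x y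
    _ = _ := by simp; ring

/-- Cauchy–Schwarz between the two gradient conditions at a nonzero point, which exists because `p >
0`. -/
theorem StronglyConvexSmooth.le (hf : StronglyConvexSmooth f μ L) (hn : 0 < n) (hp : 0 < p) :
    μ ≤ L := by
  obtain ⟨x, hx⟩ : ∃ x : EuclideanSpace ℝ (Fin p), x ≠ 0 := by
    have : Nonempty (Fin p) := ⟨⟨0, hp⟩⟩
    exact exists_ne 0
  have h1 := hf.strong ⟨0, hn⟩ x 0
  have h2 := real_inner_le_norm (gradient (f ⟨0, hn⟩) x - gradient (f ⟨0, hn⟩) 0) (x - 0)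
  have h3 := hf.lipschitz ⟨0, hn⟩ x 0
  rw [sub_zero] at h1 h2 h3
  have hx' : 0 < ‖x‖ := norm_pos_iff.2 hx
  have h4 := mul_le_mul_of_nonneg_right h3 hx'.le
  by_contra! hlt
  nlinarith [mul_pos (sub_pos.2 hlt) (pow_pos hx' 2)]

theorem StronglyConvexSmooth.existsUnique_isOptimal (hf : StronglyConvexSmooth f μ L)
    (hn : 0 < n) (hp : 0 < p) (hμ : 0 < μ) : ∃! x, IsOptimal f x := by
  have hn' : (0 : ℝ) < n := by exact_mod_cast hn
  exact existsUnique_isMinOn hf.hasGradientAt_sum (mul_pos hn' hμ)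
    (mul_le_mul_of_nonneg_left (hf.le hn hp) hn'.le) hf.le_inner_sum hf.norm_sum_sub_le

theorem StronglyConvexSmooth.sum_gradient_eq_zero (hf : StronglyConvexSmooth f μ L)
    {xs : EuclideanSpace ℝ (Fin p)} (hxs : IsOptimal f xs) : ∑ i, gradient (f i) xs = 0 :=
  gradient_eq_zero_of_isMinOn hf.hasGradientAt_sum hxs

/-- One step of gradient descent for the average of the `f i`. -/
theorem StronglyConvexSmooth.norm_mean_step_le (hf : StronglyConvexSmooth f μ L) (hn : 0 < n)
    (hp : 0 < p) (hμ : 0 < μ) {t : ℝ} (ht0 : 0 ≤ t) (ht : t ≤ 2 / (μ + L))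
    {xs : EuclideanSpace ℝ (Fin p)} (hxs : IsOptimal f xs) (x : EuclideanSpace ℝ (Fin p)) :
    ‖x - xs - (t / n) • ∑ i, gradient (f i) x‖ ≤ (1 - t * μ) * ‖x - xs‖ := by
  have hn' : (0 : ℝ) < n := by exact_mod_cast hn
  have hμL := hf.le hn hp
  -- The sum has constants `n μ` and `n L`, so a step `t` for the average is a step `t / n` for the
  -- sum.
  have h := norm_gradient_step_le hf.hasGradientAt_sum (mul_pos hn' hμ)
    (mul_le_mul_of_nonneg_left hμL hn'.le) hf.le_inner_sum hf.norm_sum_sub_le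
    (div_nonneg ht0 hn'.le) ?_ x xs
  · have e : t / n * (n * μ) = t * μ := by field_simp
    rwa [hf.sum_gradient_eq_zero hxs, sub_zero, e] at h
  · rw [← mul_add, div_le_iff₀ hn']
    have hne : μ + L ≠ 0 := by linarith
    have e : 2 / (n * (μ + L)) * n = 2 / (μ + L) := by field_simp
    rwa [e]

end Objective

/-! ### The spectral radius of a nonnegative matrix -/

section SpectralRadius

variable {m : ℕ} {A : Matrix (Fin m) (Fin m) ℝ}

/-- A positive vector `w` with `A w ≤ r w` bounds the spectral radius of a nonnegative matrix
by `r`. -/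
theorem specRadius_le_ofReal (hA : ∀ i j, 0 ≤ A i j) {w : Fin m → ℝ} (hw : ∀ i, 0 < w i) {r : ℝ}
    (h : ∀ i, (A *ᵥ w) i ≤ r * w i) : specRadius A ≤ ENNReal.ofReal r := by
  refine iSup₂_le fun z hz => ?_
  rw [spectrum.mem_iff, Matrix.isUnit_iff_isUnit_det, isUnit_iff_ne_zero, not_not] at hz
  obtain ⟨x, hx0, hx⟩ := Matrix.exists_mulVec_eq_zero_iff.2 hz
  rw [Matrix.sub_mulVec, sub_eq_zero, Algebra.algebraMap_eq_smul_one, Matrix.smul_mulVec,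
    Matrix.one_mulVec] at hx
  obtain ⟨i₁, hi₁⟩ := Function.ne_iff.1 hx0
  have : Nonempty (Fin m) := ⟨i₁⟩
  -- Read the eigenvalue equation at the index where the eigenvector is largest relative to `w`.
  obtain ⟨i, hi⟩ := Finite.exists_max fun i => ‖x i‖ / w i
  have hle : ∀ j, ‖x j‖ ≤ ‖x i‖ / w i * w j := fun j => (div_le_iff₀ (hw j)).1 (hi j)
  have hxi : 0 < ‖x i‖ := by
    have h1 : 0 < ‖x i₁‖ / w i₁ := div_pos (norm_pos_iff.2 hi₁) (hw i₁)
    have h2 := h1.trans_le (hi i₁)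
    by_contra! h3
    exact absurd h2 (not_lt.2 (div_nonpos_of_nonpos_of_nonneg h3 (hw i).le))
  have key : ‖z‖ * ‖x i‖ ≤ r * ‖x i‖ := by
    calc ‖z‖ * ‖x i‖ = ‖∑ j, (A i j : ℂ) * x j‖ := by
          rw [← norm_mul]; exact congrArg norm (congrFun hx i)
      _ ≤ ∑ j, A i j * ‖x j‖ := by
          refine (norm_sum_le _ _).trans_eq (Finset.sum_congr rfl fun j _ => ?_)
          rw [norm_mul, Complex.norm_of_nonneg (hA i j)]
      _ ≤ ∑ j, A i j * (‖x i‖ / w i * w j) :=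
          Finset.sum_le_sum fun j _ => mul_le_mul_of_nonneg_left (hle j) (hA i j)
      _ = ‖x i‖ / w i * (A *ᵥ w) i := by
          rw [Matrix.mulVec, dotProduct, Finset.mul_sum]
          exact Finset.sum_congr rfl fun j _ => by ring
      _ ≤ ‖x i‖ / w i * (r * w i) :=
          mul_le_mul_of_nonneg_left (h i) (div_nonneg hxi.le (hw i).le)
      _ = r * ‖x i‖ := by have := (hw i).ne'; field_simp
  have hzr : ‖z‖ ≤ r := le_of_mul_le_mul_right key hxi
  rw [← enorm_eq_nnnorm, ← ofReal_norm]
  exact ENNReal.ofReal_le_ofReal hzr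

attribute [local instance] Matrix.linftyOpNormedRing Matrix.linftyOpNormedAlgebra in
/-- A real number above the spectral radius bounds the row sums of some power. -/
theorem exists_pow_mulVec_one_le {r : ℝ} (h : specRadius A < ENNReal.ofReal r) :
    ∃ N, 0 < N ∧ ∀ i, (A ^ N *ᵥ 1) i ≤ r ^ N := by
  have hr : 0 < r := ENNReal.ofReal_pos.1 (bot_le.trans_lt h)
  -- Gelfand's formula in the `ℓ^∞` operator norm, which bounds `A ^ N *ᵥ 1` entrywise.
  have hlim := spectrum.pow_norm_pow_one_div_tendsto_nhds_spectralRadius (A.map (algebraMap ℝ ℂ))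
  obtain ⟨N, hN, hN0⟩ :=
    ((hlim.eventually (gt_mem_nhds h)).and (Filter.eventually_gt_atTop 0)).exists
  refine ⟨N, hN0, fun i => ?_⟩
  rw [ENNReal.ofReal_lt_ofReal_iff hr, one_div] at hN
  have hpow : ‖A.map (algebraMap ℝ ℂ) ^ N‖ ≤ r ^ N := by
    have := pow_le_pow_left₀ (by positivity) hN.le N
    rwa [Real.rpow_inv_natCast_pow (norm_nonneg _) hN0.ne'] at this
  have : Nonempty (Fin m) := ⟨i⟩
  have hmul := Matrix.linfty_opNorm_mulVec (A.map (algebraMap ℝ ℂ) ^ N) (1 : Fin m → ℂ)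
  rw [norm_one, mul_one] at hmul
  have hentry := (norm_le_pi_norm (A.map (algebraMap ℝ ℂ) ^ N *ᵥ (1 : Fin m → ℂ)) i).trans
    (hmul.trans hpow)
  have hcast : (A.map (algebraMap ℝ ℂ) ^ N *ᵥ (1 : Fin m → ℂ)) i = (((A ^ N *ᵥ 1) i : ℝ) : ℂ) := by
    have e : A.map (algebraMap ℝ ℂ) ^ N = (A ^ N).map (algebraMap ℝ ℂ) :=
      (map_pow (algebraMap ℝ ℂ).mapMatrix A N).symm
    rw [e]
    simp [Matrix.mulVec, dotProduct]
  rw [hcast, Complex.norm_real] at hentry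
  exact (le_abs_self _).trans hentry

/-- For `B = r⁻¹ A` and `N` with `B ^ N 1 ≤ 1`, the vector `w = ∑ B ^ k 1` over `k < N` satisfies `B
w = w - 1 + B ^ N 1 ≤ w`; its term `k = 0` gives `w ≥ 1`. -/
theorem exists_mulVec_le_of_specRadius_lt (hA : ∀ i j, 0 ≤ A i j) {r : ℝ}
    (h : specRadius A < ENNReal.ofReal r) :
    ∃ w : Fin m → ℝ, (∀ i, 1 ≤ w i) ∧ ∀ i, (A *ᵥ w) i ≤ r * w i := by
  have hr : 0 < r := ENNReal.ofReal_pos.1 (bot_le.trans_lt h)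
  obtain ⟨N, hN0, hN⟩ := exists_pow_mulVec_one_le h
  set B : Matrix (Fin m) (Fin m) ℝ := r⁻¹ • A with hB
  have hB0 : ∀ i j, 0 ≤ B i j := fun i j => mul_nonneg (inv_nonneg.2 hr.le) (hA i j)
  have hBk : ∀ k i, 0 ≤ (B ^ k *ᵥ 1) i := fun k i => by
    have h : 0 ≤ ∑ j, (B ^ k) i j * 1 :=
      Finset.sum_nonneg fun j _ => mul_nonneg (pow_entry_nonneg hB0 k i j) zero_le_one
    exact h
  have hBN : ∀ i, (B ^ N *ᵥ 1) i ≤ 1 := fun i => by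
    rw [hB, smul_pow, Matrix.smul_mulVec, Pi.smul_apply, smul_eq_mul, inv_pow,
      inv_mul_le_iff₀ (by positivity), mul_one]
    exact hN i
  have hAB : A = r • B := by rw [hB, smul_smul, mul_inv_cancel₀ hr.ne', one_smul]
  refine ⟨∑ k ∈ Finset.range N, B ^ k *ᵥ 1, fun i => ?_, fun i => ?_⟩
  · rw [Finset.sum_apply]
    simpa using Finset.single_le_sum (f := fun k => (B ^ k *ᵥ (1 : Fin m → ℝ)) i)
      (fun k _ => hBk k i) (Finset.mem_range.2 hN0)
  · rw [hAB, Matrix.smul_mulVec, Pi.smul_apply, smul_eq_mul]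
    refine mul_le_mul_of_nonneg_left ?_ hr.le
    have e := Finset.sum_range_succ' (fun k => (B ^ k *ᵥ (1 : Fin m → ℝ)) i) N
    rw [Finset.sum_range_succ] at e
    simp only [Matrix.mulVec_sum, Matrix.mulVec_mulVec, ← pow_succ', Finset.sum_apply]
    have := hBN i
    simp only [pow_zero, Matrix.one_mulVec, Pi.one_apply] at e
    linarith

/-- A nonnegative matrix has a nonnegative nonzero vector `w` with `A w ≤ ρ w`, where `ρ` is its
spectral radius. -/
theorem exists_mulVec_le_specRadius (hm : 0 < m) (hA : ∀ i j, 0 ≤ A i j)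
    (hfin : specRadius A ≠ ⊤) :
    ∃ w : Fin m → ℝ, (∀ i, 0 ≤ w i) ∧ ∑ i, w i = 1 ∧
      ∀ i, (A *ᵥ w) i ≤ (specRadius A).toReal * w i := by
  have : Nonempty (Fin m) := ⟨⟨0, hm⟩⟩
  set ρ := (specRadius A).toReal with hρ
  -- Normalized vectors for bounds decreasing to `ρ` have a limit point in the compact simplex. It
  -- may have zero entries.
  have hex : ∀ k : ℕ, ∃ w ∈ stdSimplex ℝ (Fin m),
      ∀ i, (A *ᵥ w) i ≤ (ρ + 1 / ((k : ℝ) + 1)) * w i := fun k => by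
    have hlt : specRadius A < ENNReal.ofReal (ρ + 1 / ((k : ℝ) + 1)) := by
      rw [ENNReal.lt_ofReal_iff_toReal_lt hfin]
      have : (0 : ℝ) < 1 / ((k : ℝ) + 1) := by positivity
      linarith
    obtain ⟨w, hw1, hw⟩ := exists_mulVec_le_of_specRadius_lt hA hlt
    have hpos : 0 < ∑ i, w i :=
      Finset.sum_pos (fun i _ => zero_lt_one.trans_le (hw1 i)) Finset.univ_nonempty
    refine ⟨(∑ i, w i)⁻¹ • w, ⟨fun i => ?_, ?_⟩, fun i => ?_⟩
    · exact mul_nonneg (inv_nonneg.2 hpos.le) (zero_le_one.trans (hw1 i))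
    · simp only [Pi.smul_apply, smul_eq_mul, ← Finset.mul_sum]
      exact inv_mul_cancel₀ hpos.ne'
    · rw [Matrix.mulVec_smul, Pi.smul_apply, Pi.smul_apply, smul_eq_mul, smul_eq_mul,
        mul_left_comm]
      exact mul_le_mul_of_nonneg_left (hw i) (inv_nonneg.2 hpos.le)
  choose w hw hle using hex
  obtain ⟨x, hx, φ, hφ, hlim⟩ := (isCompact_stdSimplex ℝ (Fin m)).tendsto_subseq hw
  refine ⟨x, hx.1, hx.2, fun i => ?_⟩
  have h1 : Filter.Tendsto (fun k => (A *ᵥ w (φ k)) i) Filter.atTop (nhds ((A *ᵥ x) i)) :=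
    (((continuous_apply i).comp (continuous_const.matrix_mulVec continuous_id)).tendsto x).comp
      hlim
  have h2 : Filter.Tendsto (fun k => (ρ + 1 / ((φ k : ℝ) + 1)) * w (φ k) i) Filter.atTop
      (nhds ((ρ + 0) * x i)) :=
    (tendsto_const_nhds.add (tendsto_one_div_add_atTop_nhds_zero_nat.comp hφ.tendsto_atTop)).mul
      (((continuous_apply i).tendsto x).comp hlim)
  rw [add_zero] at h2
  exact le_of_tendsto_of_tendsto' h1 h2 fun k => hle (φ k) i

end SpectralRadius

/-- A nonnegative `3 × 3` matrix with diagonal entries less than `1` and `det (1 - A) > 0` has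
spectral radius less than `1`. -/
theorem specRadius_lt_one_of_det_pos {A : Matrix (Fin 3) (Fin 3) ℝ} (hA : ∀ i j, 0 ≤ A i j)
    (hdiag : ∀ i, A i i < 1) (hdet : 0 < (1 - A).det) : specRadius A < 1 := by
  set D := (1 - A).det with hD
  have hDe := Matrix.det_fin_three (1 - A)
  rw [← hD] at hDe
  simp at hDe
  have b0 : 0 < 1 - A 0 0 := sub_pos.2 (hdiag 0)
  have b1 : 0 < 1 - A 1 1 := sub_pos.2 (hdiag 1)
  have b2 : 0 < 1 - A 2 2 := sub_pos.2 (hdiag 2)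
  have p {a b c : ℝ} (ha : 0 ≤ a) (hb : 0 ≤ b) (hc : 0 ≤ c) : 0 ≤ a * b * c :=
    mul_nonneg (mul_nonneg ha hb) hc
  have t1 := p (hA 0 1) (hA 1 2) (hA 2 0)
  have t2 := p (hA 0 2) (hA 1 0) (hA 2 1)
  have t3 := p b1.le (hA 0 2) (hA 2 0)
  have t4 := p b2.le (hA 0 1) (hA 1 0)
  have t5 := p b0.le (hA 1 2) (hA 2 1)
  -- In the expansion of `D`, all terms outside `1 - A 0 0` times this minor are nonpositive, so `D
  -- > 0` makes the minor positive. The other two are symmetric.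
  have m0 : 0 < (1 - A 1 1) * (1 - A 2 2) - A 1 2 * A 2 1 :=
    pos_of_mul_pos_right (a := 1 - A 0 0) (by linarith) b0.le
  have m1 : 0 < (1 - A 0 0) * (1 - A 2 2) - A 0 2 * A 2 0 :=
    pos_of_mul_pos_right (a := 1 - A 1 1) (by linarith) b1.le
  have m2 : 0 < (1 - A 0 0) * (1 - A 1 1) - A 0 1 * A 1 0 :=
    pos_of_mul_pos_right (a := 1 - A 2 2) (by linarith) b2.le
  have q {i j k l : Fin 3} : 0 ≤ A i j * A k l := mul_nonneg (hA i j) (hA k l)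
  -- The witness is the vector of row sums of the adjugate of `1 - A`, so `(1 - A) w = D • 1`.
  obtain ⟨w, hw, hAw⟩ : ∃ w : Fin 3 → ℝ, (∀ i, 0 < w i) ∧ ∀ i, (A *ᵥ w) i = w i - D := by
    refine ⟨![(1 - A 1 1) * (1 - A 2 2) - A 1 2 * A 2 1 + (A 0 1 * (1 - A 2 2) + A 0 2 * A 2 1)
        + (A 0 1 * A 1 2 + A 0 2 * (1 - A 1 1)),
      (A 1 0 * (1 - A 2 2) + A 1 2 * A 2 0) + ((1 - A 0 0) * (1 - A 2 2) - A 0 2 * A 2 0)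
        + ((1 - A 0 0) * A 1 2 + A 0 2 * A 1 0),
      (A 2 0 * (1 - A 1 1) + A 1 0 * A 2 1) + ((1 - A 0 0) * A 2 1 + A 0 1 * A 2 0)
        + ((1 - A 0 0) * (1 - A 1 1) - A 0 1 * A 1 0)], fun i => ?_, fun i => ?_⟩
    · fin_cases i
      · have := mul_nonneg (hA 0 1) b2.le
        have := mul_nonneg (hA 0 2) b1.le
        have := @q 0 2 2 1
        have := @q 0 1 1 2
        simp
        linarith
      · have := mul_nonneg (hA 1 0) b2.le
        have := mul_nonneg b0.le (hA 1 2)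
        have := @q 1 2 2 0
        have := @q 0 2 1 0
        simp
        linarith
      · have := mul_nonneg (hA 2 0) b1.le
        have := mul_nonneg b0.le (hA 2 1)
        have := @q 1 0 2 1
        have := @q 0 1 2 0
        simp
        linarith
    · fin_cases i <;>
      · simp [Matrix.mulVec, dotProduct, Fin.sum_univ_three]
        linear_combination hDe
  have hle : ∀ i, w i ≤ ∑ j, w j := fun i =>
    Finset.single_le_sum (fun j _ => (hw j).le) (Finset.mem_univ i)
  have hS : 0 < ∑ j, w j := (hw 0).trans_le (hle 0)
  refine (specRadius_le_ofReal hA hw (r := 1 - D / ∑ j, w j) fun i => ?_).trans_lt ?_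
  · rw [hAw, sub_mul, one_mul, div_mul_eq_mul_div]
    have : D * w i / ∑ j, w j ≤ D := by
      rw [div_le_iff₀ hS]
      exact mul_le_mul_of_nonneg_left (hle i) hdet.le
    linarith
  · rw [← ENNReal.ofReal_one]
    exact (ENNReal.ofReal_lt_ofReal_iff zero_lt_one).2 (by linarith [div_pos hdet hS])

/-! ### The step size condition and the determinant of `1 - A` -/

/-- A step size below the positive root of `c₁ α² + c₂ α = c₃`. -/
theorem quadratic_le_of_le_root {a b c α : ℝ} (ha : 0 ≤ a) (hc : 0 ≤ c)
    (hD : 0 < b + √(b ^ 2 + 4 * a * c)) (hα : 0 < α)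
    (h : α ≤ 2 * c / (b + √(b ^ 2 + 4 * a * c))) : 0 < c ∧ a * α ^ 2 + b * α ≤ c := by
  rw [le_div_iff₀ hD] at h
  set S := √(b ^ 2 + 4 * a * c) with hS
  have hc0 : 0 < c := by nlinarith [mul_pos hα hD]
  refine ⟨hc0, ?_⟩
  have hS2 : S ^ 2 = b ^ 2 + 4 * a * c := Real.sq_sqrt (by positivity)
  have hbS : b ≤ S := Real.le_sqrt_of_sq_le (by nlinarith [mul_nonneg ha hc])
  have h1 : (S - b) * α * (α * (b + S)) ≤ (S - b) * α * (2 * c) :=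
    mul_le_mul_of_nonneg_left h (mul_nonneg (sub_nonneg.2 hbS) hα.le)
  -- Rationalization: `(S - b) (S + b) = 4 a c`. It avoids dividing by `a`, which may be zero.
  have h2 : 4 * c * (a * α ^ 2) = (S - b) * α * (α * (b + S)) := by
    linear_combination -α ^ 2 * hS2
  have h3 : a * α ^ 2 ≤ (S - b) * α / 2 := by
    refine le_of_mul_le_mul_left ?_ (show 0 < 4 * c by positivity)
    linarith
  linarith

/-- Positivity of the determinant of `1 - A` for the transition matrix, together with the bounds on
its diagonal, as a statement about real numbers: here `s`, `c` are the contraction factors, `T` is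
`uᵀv / n`, and `e`, `g`, `h`, `b`, `o` are the norms of `u - 1`, `v - 1`, `R v`, `R - 1`, `R`. -/
theorem det_one_sub_pos {s c T e g h b o δ η μ L α l k : ℝ} (hs0 : 0 ≤ s) (hs1 : s < 1)
    (hc0 : 0 ≤ c) (hc1 : c < 1) (hT : 0 < T) (he : 0 ≤ e) (hg : 0 ≤ g) (hh : 0 ≤ h) (hb : 0 ≤ b)
    (ho : 0 ≤ o) (hδ : 0 ≤ δ) (hη : 0 ≤ η) (hμ : 0 < μ) (hμL : μ ≤ L) (hα : 0 < α)
    (hl : 0 ≤ l) (hk : 0 ≤ k)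
    (hquad : s * c * η * h * L ^ 2 * l * (T * δ * (L + μ) + e * k * g * L) * α ^ 2 +
      (s * c * η * e * g * b * L ^ 2 * k + c * η * h * e * (1 - s) * L ^ 2 * k
        + s * c * δ * η * L * b * T * μ + s * g * (L ^ 2 * l) * (1 - c) * T) * α ≤
      T / 4 * μ * (1 - s) * (1 - c))
    (hstep : 2 * c * η * o * L * α ≤ 1 - c) :
    s * (1 + α * g * (L * l)) < 1 ∧ c * (1 + α * η * o * L) < 1 ∧
    0 < (1 - !![1 - α * T * μ, α * T * L * l, α * e * k;
        α * s * g * L, s * (1 + α * g * (L * l)), α * s * δ;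
        α * c * η * h * L ^ 2, c * η * L * (b + α * h * (L * l)),
          c * (1 + α * η * o * L)]).det := by
  have hL : 0 < L := hμ.trans_le hμL
  have h1s : 0 < 1 - s := by linarith
  have h1c : 0 < 1 - c := by linarith
  -- The last term of `c₂` alone, with `μ ≤ L`, already controls the middle diagonal entry.
  have hgl : s * α * g * L * l ≤ (1 - s) / 4 := by
    have p1 : 0 ≤ s * c * η * h * L ^ 2 * l * (T * δ * (L + μ) + e * k * g * L) * α ^ 2 := by
      positivity
    have p2 : 0 ≤ (s * c * η * e * g * b * L ^ 2 * k + c * η * h * e * (1 - s) * L ^ 2 * k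
        + s * c * δ * η * L * b * T * μ) * α := by positivity
    have p3 : (L * (1 - c) * T) * (s * α * g * L * l) ≤ (L * (1 - c) * T) * ((1 - s) / 4) := by
      have p4 : T / 4 * μ * (1 - s) * (1 - c) ≤ T / 4 * L * (1 - s) * (1 - c) := by gcongr
      linarith
    exact le_of_mul_le_mul_left p3 (by positivity)
  have d1 : 3 / 4 * (1 - s) ≤ 1 - s * (1 + α * g * (L * l)) := by linarith
  have d2 : 1 / 2 * (1 - c) ≤ 1 - c * (1 + α * η * o * L) := by linarith
  have d1' : 1 - s * (1 + α * g * (L * l)) ≤ 1 - s := by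
    have : 0 ≤ s * (α * g * (L * l)) := by positivity
    linarith
  refine ⟨by linarith, by linarith, ?_⟩
  have d2' : 1 - c * (1 + α * η * o * L) ≤ 1 - c := by
    have : 0 ≤ c * (α * η * o * L) := by positivity
    linarith
  rw [Matrix.det_fin_three]
  simp
  set B := 1 - s * (1 + α * g * (L * l))
  set D := 1 - c * (1 + α * η * o * L)
  -- The diagonal product retains the fraction `3 / 8` of `α T μ (1 - s) (1 - c)`. The off-diagonal
  -- terms consume at most `1 / 4` by the quadratic condition, so the determinant is strictly
  -- positive.
  have f1 : α * T * μ * (3 / 4 * (1 - s) * (1 / 2 * (1 - c))) ≤ α * T * μ * (B * D) := by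
    gcongr
    linarith
  have f2 : B * (α * e * k * (α * c * η * h * L ^ 2)) ≤
      (1 - s) * (α * e * k * (α * c * η * h * L ^ 2)) := by gcongr
  have f3 : D * (α * T * L * l * (α * s * g * L)) ≤
      (1 - c) * (α * T * L * l * (α * s * g * L)) := by gcongr
  have f4 := mul_le_mul_of_nonneg_left hquad hα.le
  have f5 : 0 < α * T * μ * ((1 - s) * (1 - c)) := by positivity
  linarith

/-! ### Row means and gradients -/

section Recursion

variable {n p : ℕ}

/-- Averaging becomes left multiplication by a rank-one matrix, which turns the step identities into
algebra among a few such matrices. -/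
theorem vecMulVec_rowMean (a w : Fin n → ℝ) (Z : Matrix (Fin n) (Fin p) ℝ) :
    Matrix.vecMulVec a (rowMean w Z) = ((1 / (n : ℝ)) • Matrix.vecMulVec a w) * Z := by
  rw [Matrix.smul_mul, Matrix.vecMulVec_mul, ← Matrix.vecMulVec_smul]
  rfl

theorem rowMean_sub (w : Fin n → ℝ) (Z Z' : Matrix (Fin n) (Fin p) ℝ) :
    rowMean w (Z - Z') = rowMean w Z - rowMean w Z' := by
  ext j
  simp [rowMean, Matrix.vecMul_sub, mul_sub]

theorem norm_rowMean_one_le (hn : 0 < n) (Z : Matrix (Fin n) (Fin p) ℝ) :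
    ‖rowMean 1 Z‖ ≤ 1 / √n * matNorm (l2 n) Z := by
  have hn' : (0 : ℝ) < n := by exact_mod_cast hn
  have h := l2_vecMul_le 1 Z
  rw [l2_one] at h
  have e : ‖rowMean 1 Z‖ = 1 / n * l2 p (1 ᵥ* Z) := by
    have h' := map_smul_eq_mul (l2 p) (1 / (n : ℝ)) (1 ᵥ* Z)
    rwa [Real.norm_of_nonneg (by positivity)] at h'
  calc ‖rowMean 1 Z‖ = 1 / n * l2 p (1 ᵥ* Z) := e
    _ ≤ 1 / n * (√n * matNorm (l2 n) Z) := by gcongr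
    _ = 1 / √n * matNorm (l2 n) Z := by
        have h1 : √(n : ℝ) ≠ 0 := (Real.sqrt_pos.2 hn').ne'
        have h2 : (n : ℝ) = √n * √n := (Real.mul_self_sqrt hn'.le).symm
        rw [← mul_assoc]
        congr 1
        field_simp
        linarith

variable {f : Fin n → EuclideanSpace ℝ (Fin p) → ℝ} {μ L : ℝ}

theorem rowMean_one_gradF (X : Matrix (Fin n) (Fin p) ℝ) :
    rowMean 1 (gradF f X) = (1 / (n : ℝ)) • ∑ i, gradient (f i) (WithLp.toLp 2 (X i)) := by
  ext j
  simp [rowMean, gradF, Matrix.vecMul, dotProduct]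

theorem StronglyConvexSmooth.matNorm_gradF_sub_le (hf : StronglyConvexSmooth f μ L) (hL : 0 ≤ L)
    (X X' : Matrix (Fin n) (Fin p) ℝ) :
    matNorm (l2 n) (gradF f X - gradF f X') ≤ L * matNorm (l2 n) (X - X') := by
  have e : L * matNorm (l2 n) (X - X') = √(∑ i, L ^ 2 * l2 p ((X - X') i) ^ 2) := by
    rw [← Finset.mul_sum, Real.sqrt_mul (sq_nonneg L), Real.sqrt_sq hL, matNorm_l2_eq_rows]
  rw [e, matNorm_l2_eq_rows]
  refine Real.sqrt_le_sqrt (Finset.sum_le_sum fun i _ => ?_)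
  rw [← mul_pow]
  exact pow_le_pow_left₀ (apply_nonneg _ _)
    (hf.lipschitz i (WithLp.toLp 2 (X i)) (WithLp.toLp 2 (X' i))) 2

theorem StronglyConvexSmooth.norm_rowMean_gradF_sub_le (hf : StronglyConvexSmooth f μ L)
    (hn : 0 < n) (hL : 0 ≤ L) (X : Matrix (Fin n) (Fin p) ℝ) (x : EuclideanSpace ℝ (Fin p)) :
    ‖rowMean 1 (gradF f X) - (1 / (n : ℝ)) • ∑ i, gradient (f i) x‖ ≤
      L / √n * matNorm (l2 n) (X - Matrix.vecMulVec 1 x) := by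
  have hx : ∀ i, WithLp.toLp 2 (Matrix.vecMulVec (1 : Fin n → ℝ) x i) = x := fun i => by
    ext j; simp [Matrix.vecMulVec_apply]
  have e : (1 / (n : ℝ)) • ∑ i, gradient (f i) x =
      rowMean 1 (gradF f (Matrix.vecMulVec (1 : Fin n → ℝ) x)) := by
    rw [rowMean_one_gradF]
    simp only [hx]
  rw [e, ← rowMean_sub]
  calc _ ≤ 1 / √n * matNorm (l2 n) (gradF f X - gradF f (Matrix.vecMulVec 1 x)) :=
        norm_rowMean_one_le hn _
    _ ≤ 1 / √n * (L * matNorm (l2 n) (X - Matrix.vecMulVec 1 x)) := by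
        gcongr
        exact hf.matNorm_gradF_sub_le hL _ _
    _ = _ := by ring

theorem StronglyConvexSmooth.norm_rowMean_gradF_le (hf : StronglyConvexSmooth f μ L)
    (hn : 0 < n) (hL : 0 ≤ L) {xs : EuclideanSpace ℝ (Fin p)} (hxs : IsOptimal f xs)
    (X : Matrix (Fin n) (Fin p) ℝ) (x : EuclideanSpace ℝ (Fin p)) :
    ‖rowMean 1 (gradF f X)‖ ≤
      L / √n * matNorm (l2 n) (X - Matrix.vecMulVec 1 x) + L * ‖x - xs‖ := by
  have hn' : (0 : ℝ) < n := by exact_mod_cast hn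
  have h1 := hf.norm_rowMean_gradF_sub_le hn hL X x
  have h2 : ‖(1 / (n : ℝ)) • ∑ i, gradient (f i) x‖ ≤ L * ‖x - xs‖ := by
    have := hf.norm_sum_sub_le x xs
    rw [hf.sum_gradient_eq_zero hxs, sub_zero] at this
    rw [norm_smul, Real.norm_of_nonneg (by positivity)]
    calc 1 / (n : ℝ) * ‖∑ i, gradient (f i) x‖ ≤ 1 / n * (n * L * ‖x - xs‖) := by gcongr
      _ = L * ‖x - xs‖ := by field_simp
  have h3 := norm_add_le (rowMean 1 (gradF f X) - (1 / (n : ℝ)) • ∑ i, gradient (f i) x)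
    ((1 / (n : ℝ)) • ∑ i, gradient (f i) x)
  rw [sub_add_cancel] at h3
  linarith

/-! ### The averaging projections -/

variable {R C : Matrix (Fin n) (Fin n) ℝ} {u v : Fin n → ℝ}

theorem mul_vecMulVec_smul (W : Matrix (Fin n) (Fin n) ℝ) (a b : Fin n → ℝ) (c : ℝ) :
    W * (c • Matrix.vecMulVec a b) = c • Matrix.vecMulVec (W *ᵥ a) b := by
  rw [Matrix.mul_smul, Matrix.mul_vecMulVec]

theorem vecMulVec_smul_mul (W : Matrix (Fin n) (Fin n) ℝ) (a b : Fin n → ℝ) (c : ℝ) :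
    (c • Matrix.vecMulVec a b) * W = c • Matrix.vecMulVec a (b ᵥ* W) := by
  rw [Matrix.smul_mul, Matrix.vecMulVec_mul]

theorem mean_mul_mean (hn : 0 < n) {a b c d : Fin n → ℝ} (h : b ⬝ᵥ c = n) :
    ((1 / (n : ℝ)) • Matrix.vecMulVec a b) * ((1 / (n : ℝ)) • Matrix.vecMulVec c d) =
      (1 / (n : ℝ)) • Matrix.vecMulVec a d := by
  have hn' : (n : ℝ) ≠ 0 := by exact_mod_cast hn.ne'
  rw [Matrix.smul_mul, Matrix.mul_smul, Matrix.vecMulVec_mul_vecMulVec, h,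
    Matrix.vecMulVec_smul, smul_smul, smul_smul]
  congr 1
  field_simp

/-- The consensus error after the step `X ↦ R (X - α Y)`. -/
theorem consensus_step (hn : 0 < n) (hR : R *ᵥ 1 = 1) (hu : IsLeftVec R u) (v : Fin n → ℝ) (α : ℝ)
    (X Y : Matrix (Fin n) (Fin p) ℝ) :
    R * (X - α • Y) - Matrix.vecMulVec 1 (rowMean u (R * (X - α • Y))) =
      (R - (1 / (n : ℝ)) • Matrix.vecMulVec 1 u) * (X - Matrix.vecMulVec 1 (rowMean u X)) -
        α • ((R - (1 / (n : ℝ)) • Matrix.vecMulVec 1 u) *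
          ((Y - Matrix.vecMulVec v (rowMean 1 Y)) + Matrix.vecMulVec (v - 1) (rowMean 1 Y))) := by
  have hsum : u ⬝ᵥ 1 = (n : ℝ) := by rw [dotProduct_one]; exact hu.sum_eq
  have hPR := vecMulVec_smul_mul R 1 u (1 / (n : ℝ))
  have hRP := mul_vecMulVec_smul R 1 u (1 / (n : ℝ))
  have hPP := mean_mul_mean hn (a := 1) (d := u) hsum
  have hRQ := mul_vecMulVec_smul R 1 1 (1 / (n : ℝ))
  have hPQ := mean_mul_mean hn (a := 1) (d := 1) hsum
  rw [hu.eigen] at hPR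
  rw [hR] at hRP hRQ
  simp only [vecMulVec_rowMean, Matrix.sub_vecMulVec]
  set P : Matrix (Fin n) (Fin n) ℝ := (1 / (n : ℝ)) • Matrix.vecMulVec 1 u
  set Q : Matrix (Fin n) (Fin n) ℝ := (1 / (n : ℝ)) • Matrix.vecMulVec 1 1
  set V : Matrix (Fin n) (Fin n) ℝ := (1 / (n : ℝ)) • Matrix.vecMulVec v 1
  -- The terms with `V` cancel, and `R - P` annihilates `Q` since `R Q = P Q = Q`; thus `v` may be
  -- arbitrary here.
  rw [sub_add_sub_cancel, ← Matrix.mul_assoc P R, hPR]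
  simp only [Matrix.sub_mul, Matrix.mul_sub, ← Matrix.mul_assoc, hPP, hRP, hRQ, hPQ,
    Matrix.mul_smul, smul_sub]
  abel

/-- The tracking error after the step `Y ↦ C (Y + G)`. -/
theorem tracking_step (hn : 0 < n) (hC : 1 ᵥ* C = 1) (hv : IsRightVec C v)
    (Y G : Matrix (Fin n) (Fin p) ℝ) :
    C * (Y + G) - Matrix.vecMulVec v (rowMean 1 (C * (Y + G))) =
      (C - (1 / (n : ℝ)) • Matrix.vecMulVec v 1) *
        ((Y - Matrix.vecMulVec v (rowMean 1 Y)) + G) := by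
  have hsum : 1 ⬝ᵥ v = (n : ℝ) := by rw [one_dotProduct]; exact hv.sum_eq
  have hPC := vecMulVec_smul_mul C v 1 (1 / (n : ℝ))
  have hCP := mul_vecMulVec_smul C v 1 (1 / (n : ℝ))
  have hPP := mean_mul_mean hn (a := v) (d := 1) hsum
  rw [hC] at hPC
  rw [hv.eigen] at hCP
  simp only [vecMulVec_rowMean]
  set P : Matrix (Fin n) (Fin n) ℝ := (1 / (n : ℝ)) • Matrix.vecMulVec v 1
  rw [← Matrix.mul_assoc P C, hPC]
  simp only [Matrix.sub_mul, Matrix.mul_sub, Matrix.mul_add, ← Matrix.mul_assoc, hPP, hCP]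
  abel

/-- The displacement of the step `X ↦ R (X - α Y)`. -/
theorem displacement_eq (hR : R *ᵥ 1 = 1) (u v : Fin n → ℝ) (α : ℝ)
    (X Y : Matrix (Fin n) (Fin p) ℝ) :
    R * (X - α • Y) - X = (R - 1) * (X - Matrix.vecMulVec 1 (rowMean u X)) -
      α • (R * (Y - Matrix.vecMulVec v (rowMean 1 Y)) +
        Matrix.vecMulVec (R *ᵥ v) (rowMean 1 Y)) := by
  rw [← Matrix.mul_vecMulVec]
  simp only [Matrix.mul_sub, Matrix.sub_mul, Matrix.mul_smul, Matrix.mul_vecMulVec, hR,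
    Matrix.sub_mulVec, Matrix.one_mulVec, sub_self, Matrix.zero_vecMulVec, Matrix.one_mul,
    smul_add, smul_sub]
  abel

/-- The weighted mean after the step `X ↦ R (X - α Y)`. -/
theorem rowMean_step (hn : 0 < n) (hu : IsLeftVec R u) (hv : IsRightVec C v) (α : ℝ)
    (X Y : Matrix (Fin n) (Fin p) ℝ) :
    rowMean u (R * (X - α • Y)) = rowMean u X - effStep u v α • rowMean 1 Y -
      (α / n) • WithLp.toLp 2 ((u - 1) ᵥ* (Y - Matrix.vecMulVec v (rowMean 1 Y))) := by
  have hn' : (n : ℝ) ≠ 0 := by exact_mod_cast hn.ne'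
  have hsum : 1 ⬝ᵥ v = (n : ℝ) := by rw [one_dotProduct]; exact hv.sum_eq
  have e : (u - 1) ᵥ* (Y - Matrix.vecMulVec v (rowMean 1 Y)) =
      u ᵥ* Y - ((u ⬝ᵥ v) / n) • (1 ᵥ* Y) := by
    have e1 : Matrix.vecMulVec v (rowMean 1 Y) =
        Matrix.vecMulVec v ((1 / (n : ℝ)) • ((1 : Fin n → ℝ) ᵥ* Y)) := rfl
    rw [e1, Matrix.vecMul_sub, Matrix.vecMul_vecMulVec, Matrix.sub_vecMul, sub_dotProduct, hsum,
      smul_smul, sub_mul, mul_one_div, mul_one_div, div_self hn', sub_smul, one_smul]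
    abel
  rw [e]
  ext j
  simp only [rowMean, effStep, ← Matrix.vecMul_vecMul, hu.eigen, Matrix.vecMul_sub,
    Matrix.vecMul_smul, PiLp.sub_apply, PiLp.smul_apply, Pi.sub_apply, Pi.smul_apply, smul_eq_mul]
  ring

end Recursion

/-! ### The linear system of inequalities for the errors -/

section Errors

variable {n p : ℕ} {f : Fin n → EuclideanSpace ℝ (Fin p) → ℝ} {μ L α : ℝ}
  {R C : Matrix (Fin n) (Fin n) ℝ} {u v : Fin n → ℝ} {NR NC : Seminorm ℝ (Fin n → ℝ)}
  {δRC δC2 : ℝ}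

theorem AdmissibleNorms.matNorm_sigmaR_le (hN : AdmissibleNorms p R C u v NR NC δRC δC2)
    (hp : 0 < p) (Z : Matrix (Fin n) (Fin p) ℝ) :
    matNorm NR ((R - (1 / (n : ℝ)) • Matrix.vecMulVec 1 u) * Z) ≤ sigmaR R u NR * matNorm NR Z := by
  refine matNorm_mul_le (inducedNorm_nonneg _ _) (fun x => ?_) Z
  refine apply_mulVec_le_inducedNorm (mul_pos hN.δRC_pos hN.δC2_pos).le (fun x => ?_)
    (fun x => ?_) _ x
  · simpa using le_of_matNorm_le hp (c := 1) (by simpa using hN.l2_le_R) x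
  · rw [mul_assoc]
    exact (le_of_matNorm_le hp hN.R_le_C x).trans
      (mul_le_mul_of_nonneg_left (le_of_matNorm_le hp hN.C_le_l2 x) hN.δRC_pos.le)

theorem AdmissibleNorms.matNorm_sigmaC_le (hN : AdmissibleNorms p R C u v NR NC δRC δC2)
    (hp : 0 < p) (Z : Matrix (Fin n) (Fin p) ℝ) :
    matNorm NC ((C - (1 / (n : ℝ)) • Matrix.vecMulVec v 1) * Z) ≤ sigmaC C v NC * matNorm NC Z := by
  refine matNorm_mul_le (inducedNorm_nonneg _ _) (fun x => ?_) Z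
  refine apply_mulVec_le_inducedNorm hN.δC2_pos.le (fun x => ?_)
    (le_of_matNorm_le hp hN.C_le_l2) _ x
  simpa using le_of_matNorm_le hp (c := 1) (by simpa using hN.l2_le_C) x

/-- Adding and subtracting the average gradient at the mean splits the step into an exact gradient
step, a Lipschitz term for consensus, and a tracking term. The last carries `u - 1` because the
tracking deviation has column sums zero. -/
theorem optError_step_le (hf : StronglyConvexSmooth f μ L) (hn : 0 < n) (hp : 0 < p) (hμ : 0 < μ)
    (hu : IsLeftVec R u) (hv : IsRightVec C v) (hN : AdmissibleNorms p R C u v NR NC δRC δC2)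
    (hα : 0 ≤ α) (hα' : effStep u v α ≤ 2 / (μ + L)) {xs : EuclideanSpace ℝ (Fin p)}
    (hxs : IsOptimal f xs) {X Y : Matrix (Fin n) (Fin p) ℝ}
    (hY : rowMean 1 Y = rowMean 1 (gradF f X)) :
    optError u xs (R * (X - α • Y)) ≤ (1 - effStep u v α * μ) * optError u xs X +
      effStep u v α * L / √n * consError NR u X + α * l2 n (u - 1) / n * trackError NC v Y := by
  have hL : 0 ≤ L := hμ.le.trans (hf.le hn hp)
  have ht : 0 ≤ effStep u v α := mul_nonneg (by positivity)
    (Finset.sum_nonneg fun i _ => mul_nonneg (hu.nonneg i) (hv.nonneg i))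
  unfold optError
  rw [rowMean_step hn hu hv]
  set t := effStep u v α
  set x := rowMean u X with hx
  set g := ∑ i, gradient (f i) x with hg
  set E := Y - Matrix.vecMulVec v (rowMean 1 Y) with hE
  have h1 := hf.norm_mean_step_le hn hp hμ ht hα' hxs x
  rw [← hg] at h1
  have h2 : ‖t • (rowMean 1 Y - (1 / (n : ℝ)) • g)‖ ≤ t * L / √n * consError NR u X := by
    rw [norm_smul, Real.norm_of_nonneg ht, hY, mul_div_assoc, mul_assoc]
    refine mul_le_mul_of_nonneg_left ((hf.norm_rowMean_gradF_sub_le hn hL X x).trans ?_) ht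
    exact mul_le_mul_of_nonneg_left (hN.l2_le_R _) (by positivity)
  have h3 : ‖(α / n) • (WithLp.toLp 2 ((u - 1) ᵥ* E) : EuclideanSpace ℝ (Fin p))‖ ≤
      α * l2 n (u - 1) / n * trackError NC v Y := by
    rw [norm_smul, Real.norm_of_nonneg (by positivity), mul_div_right_comm, mul_assoc]
    refine mul_le_mul_of_nonneg_left ((l2_vecMul_le (u - 1) E).trans ?_) (by positivity)
    exact mul_le_mul_of_nonneg_left (hN.l2_le_C _) (apply_nonneg _ _)
  have e : x - t • rowMean 1 Y - (α / n) • WithLp.toLp 2 ((u - 1) ᵥ* E) - xs =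
      (x - xs - (t / n) • g) - t • (rowMean 1 Y - (1 / (n : ℝ)) • g) -
        (α / n) • WithLp.toLp 2 ((u - 1) ᵥ* E) := by
    rw [smul_sub, smul_smul, mul_one_div]
    abel
  rw [e]
  refine (norm_sub_le _ _).trans (add_le_add ((norm_sub_le _ _).trans (add_le_add h1 h2)) h3)

/-- The bound on the mean of the tracked gradients by the errors. -/
theorem norm_rowMean_le (hf : StronglyConvexSmooth f μ L) (hn : 0 < n) (hL : 0 ≤ L)
    (hN : AdmissibleNorms p R C u v NR NC δRC δC2) {xs : EuclideanSpace ℝ (Fin p)}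
    (hxs : IsOptimal f xs) {X Y : Matrix (Fin n) (Fin p) ℝ}
    (hY : rowMean 1 Y = rowMean 1 (gradF f X)) :
    ‖rowMean 1 Y‖ ≤ L / √n * consError NR u X + L * optError u xs X := by
  rw [hY]
  refine (hf.norm_rowMean_gradF_le hn hL hxs X (rowMean u X)).trans ?_
  unfold consError optError
  gcongr
  exact hN.l2_le_R _

theorem consError_step_le (hf : StronglyConvexSmooth f μ L) (hn : 0 < n) (hp : 0 < p)
    (hL : 0 ≤ L) (hR : R *ᵥ 1 = 1) (hu : IsLeftVec R u)
    (hN : AdmissibleNorms p R C u v NR NC δRC δC2) (hα : 0 ≤ α) {xs : EuclideanSpace ℝ (Fin p)}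
    (hxs : IsOptimal f xs) {X Y : Matrix (Fin n) (Fin p) ℝ}
    (hY : rowMean 1 Y = rowMean 1 (gradF f X)) :
    consError NR u (R * (X - α • Y)) ≤ α * sigmaR R u NR * NR (v - 1) * L * optError u xs X +
      sigmaR R u NR * (1 + α * NR (v - 1) * (L / √n)) * consError NR u X +
      α * sigmaR R u NR * δRC * trackError NC v Y := by
  have hy := norm_rowMean_le hf hn hL hN hxs hY
  have hσ : 0 ≤ sigmaR R u NR := inducedNorm_nonneg _ _
  rw [consError, consensus_step hn hR hu v]
  refine (matNorm_sub_le _ _ _).trans ?_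
  rw [matNorm_smul _ hα]
  have h1 := hN.matNorm_sigmaR_le hp (X - Matrix.vecMulVec 1 (rowMean u X))
  have h2 := hN.matNorm_sigmaR_le hp ((Y - Matrix.vecMulVec v (rowMean 1 Y)) +
    Matrix.vecMulVec (v - 1) (rowMean 1 Y))
  have h3 := matNorm_add_le NR (Y - Matrix.vecMulVec v (rowMean 1 Y))
    (Matrix.vecMulVec (v - 1) (rowMean 1 Y))
  rw [matNorm_vecMulVec] at h3
  have h4 := hN.R_le_C (Y - Matrix.vecMulVec v (rowMean 1 Y))
  have h5 : NR (v - 1) * l2 p (rowMean 1 Y) ≤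
      NR (v - 1) * (L / √n * consError NR u X + L * optError u xs X) :=
    mul_le_mul_of_nonneg_left hy (apply_nonneg _ _)
  have h6 := mul_le_mul_of_nonneg_left (h2.trans (mul_le_mul_of_nonneg_left
    (h3.trans (add_le_add h4 h5)) hσ)) hα
  refine (add_le_add h1 h6).trans_eq ?_
  unfold consError trackError
  ring

/-- The gradient increment is controlled by the displacement of the iterates, bounded in `h3` by all
three errors. -/
theorem trackError_step_le (hf : StronglyConvexSmooth f μ L) (hn : 0 < n) (hp : 0 < p)
    (hL : 0 ≤ L) (hR : R *ᵥ 1 = 1) (hC : 1 ᵥ* C = 1) (hv : IsRightVec C v)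
    (hN : AdmissibleNorms p R C u v NR NC δRC δC2) (hα : 0 ≤ α) {xs : EuclideanSpace ℝ (Fin p)}
    (hxs : IsOptimal f xs) {X Y : Matrix (Fin n) (Fin p) ℝ}
    (hY : rowMean 1 Y = rowMean 1 (gradF f X)) :
    trackError NC v (C * (Y + gradF f (R * (X - α • Y)) - gradF f X)) ≤
      α * sigmaC C v NC * δC2 * l2 n (R *ᵥ v) * L ^ 2 * optError u xs X +
      sigmaC C v NC * δC2 * L * (opNorm2 (R - 1) + α * l2 n (R *ᵥ v) * (L / √n)) *
        consError NR u X +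
      sigmaC C v NC * (1 + α * δC2 * opNorm2 R * L) * trackError NC v Y := by
  have hy := norm_rowMean_le hf hn hL hN hxs hY
  have hσ : 0 ≤ sigmaC C v NC := inducedNorm_nonneg _ _
  have hδ := hN.δC2_pos.le
  rw [trackError, add_sub_assoc, tracking_step hn hC hv]
  refine (hN.matNorm_sigmaC_le hp _).trans ?_
  set X' := R * (X - α • Y) with hX'
  have h1 := matNorm_add_le NC (Y - Matrix.vecMulVec v (rowMean 1 Y)) (gradF f X' - gradF f X)
  have h2 := (hN.C_le_l2 (gradF f X' - gradF f X)).trans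
    (mul_le_mul_of_nonneg_left (hf.matNorm_gradF_sub_le hL X' X) hδ)
  have h3 : matNorm (l2 n) (X' - X) ≤ opNorm2 (R - 1) * consError NR u X +
      α * (opNorm2 R * trackError NC v Y +
        l2 n (R *ᵥ v) * (L / √n * consError NR u X + L * optError u xs X)) := by
    rw [hX', displacement_eq hR u v]
    refine (matNorm_sub_le _ _ _).trans (add_le_add ?_ ?_)
    · refine (matNorm_mul_le (opNorm2_nonneg _) (l2_mulVec_le _) _).trans ?_
      exact mul_le_mul_of_nonneg_left (hN.l2_le_R _) (opNorm2_nonneg _)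
    · rw [matNorm_smul _ hα]
      refine mul_le_mul_of_nonneg_left ((matNorm_add_le _ _ _).trans (add_le_add ?_ ?_)) hα
      · refine (matNorm_mul_le (opNorm2_nonneg _) (l2_mulVec_le _) _).trans ?_
        exact mul_le_mul_of_nonneg_left (hN.l2_le_C _) (opNorm2_nonneg _)
      · rw [matNorm_vecMulVec]
        exact mul_le_mul_of_nonneg_left hy (apply_nonneg _ _)
  have h4 := mul_le_mul_of_nonneg_left (h1.trans (add_le_add_right (h2.trans
    (mul_le_mul_of_nonneg_left (mul_le_mul_of_nonneg_left h3 hL) hδ)) _)) hσ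
  refine h4.trans_eq ?_
  unfold trackError
  ring

/-- The sum of the tracked gradients is preserved by the iteration. -/
theorem rowMean_iter (hC : 1 ᵥ* C = 1) (X₀ : Matrix (Fin n) (Fin p) ℝ) (k : ℕ) :
    rowMean 1 (iter f R C α X₀ k).2 = rowMean 1 (gradF f (iter f R C α X₀ k).1) := by
  induction k with
  | zero => rfl
  | succ k ih =>
    have h : ∀ Z : Matrix (Fin n) (Fin p) ℝ, rowMean 1 (C * Z) = rowMean 1 Z := fun Z => by
      rw [rowMean, rowMean, ← Matrix.vecMul_vecMul, hC]
    simp only [iter]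
    rw [h, ← sub_sub_eq_add_sub, rowMean_sub, rowMean_sub, ih]
    abel

/-- The vector of the three errors. -/
def errors (f : Fin n → EuclideanSpace ℝ (Fin p) → ℝ) (R C : Matrix (Fin n) (Fin n) ℝ)
    (u v : Fin n → ℝ) (NR NC : Seminorm ℝ (Fin n → ℝ)) (α : ℝ) (xs : EuclideanSpace ℝ (Fin p))
    (X₀ : Matrix (Fin n) (Fin p) ℝ) (k : ℕ) : Fin 3 → ℝ :=
  ![optError u xs (iter f R C α X₀ k).1, consError NR u (iter f R C α X₀ k).1,
    trackError NC v (iter f R C α X₀ k).2]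

theorem errors_nonneg (xs : EuclideanSpace ℝ (Fin p)) (X₀ : Matrix (Fin n) (Fin p) ℝ) (k : ℕ)
    (i : Fin 3) : 0 ≤ errors f R C u v NR NC α xs X₀ k i := by
  fin_cases i
  exacts [norm_nonneg _, matNorm_nonneg _ _, matNorm_nonneg _ _]

theorem errors_succ_le (hf : StronglyConvexSmooth f μ L) (hn : 0 < n) (hp : 0 < p) (hμ : 0 < μ)
    (hRC : MixingMatrices R C) (hu : IsLeftVec R u) (hv : IsRightVec C v)
    (hN : AdmissibleNorms p R C u v NR NC δRC δC2)
    (hα : 0 ≤ α) (hα' : effStep u v α ≤ 2 / (μ + L)) {xs : EuclideanSpace ℝ (Fin p)}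
    (hxs : IsOptimal f xs) (X₀ : Matrix (Fin n) (Fin p) ℝ) (k : ℕ) (i : Fin 3) :
    errors f R C u v NR NC α xs X₀ (k + 1) i ≤
      (transitionMatrix R C u v NR NC δRC δC2 μ L α *ᵥ errors f R C u v NR NC α xs X₀ k) i := by
  have hL : 0 ≤ L := hμ.le.trans (hf.le hn hp)
  have hY := rowMean_iter (f := f) (R := R) (α := α) hRC.C_col X₀ k
  have h1 := optError_step_le hf hn hp hμ hu hv hN hα hα' hxs hY
  have h2 := consError_step_le hf hn hp hL hRC.R_row hu hN hα hxs hY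
  have h3 := trackError_step_le hf hn hp hL hRC.R_row hRC.C_col hv hN hα hxs hY
  fin_cases i
  · simpa [errors, iter, transitionMatrix, Matrix.mulVec, dotProduct, Fin.sum_univ_three] using h1
  · simpa [errors, iter, transitionMatrix, Matrix.mulVec, dotProduct, Fin.sum_univ_three] using h2
  · simpa [errors, iter, transitionMatrix, Matrix.mulVec, dotProduct, Fin.sum_univ_three] using h3

end Errors

/-- Linear convergence at the rate of the spectral radius for a nonnegative sequence with
`e (k + 1) ≤ A e k`, where `A` is either irreducible or irreducible apart from a vanishing row. -/
theorem linearRate_of_le_mulVec {A : Matrix (Fin 3) (Fin 3) ℝ} (hA : ∀ i j, 0 ≤ A i j)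
    (hρ : specRadius A < 1) (h01 : 0 < A 0 1) (h20 : 0 < A 2 0) (h22 : 0 < A 2 2)
    (hirr : 0 < A 1 2 ∨ (∀ j, A 1 j = 0) ∧ 0 < A 0 2) {e : ℕ → Fin 3 → ℝ}
    (he0 : ∀ k i, 0 ≤ e k i) (he : ∀ k i, e (k + 1) i ≤ (A *ᵥ e k) i) (i : Fin 3) :
    LinearRate (fun k => e k i) (specRadius A).toReal := by
  obtain ⟨w, hw0, hw1, hw⟩ := exists_mulVec_le_specRadius (by norm_num) hA hρ.ne_top
  set ρ := (specRadius A).toReal with hρdef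
  have hρ0 : 0 ≤ ρ := ENNReal.toReal_nonneg
  have hρ1 : ρ < 1 := by
    have := (ENNReal.toReal_lt_toReal hρ.ne_top ENNReal.one_ne_top).2 hρ
    rwa [ENNReal.toReal_one] at this
  -- `A w ≤ ρ w` propagates positivity of `w` along positive entries of `A`. In the irreducible case
  -- the entries `(0, 1)`, `(1, 2)`, `(2, 0)` form a cycle; otherwise `(0, 2)` and `(2, 0)` do.
  have hstep : ∀ i j, 0 < A i j → 0 < w j → 0 < w i := fun i j hij hj => by
    have h1 : A i j * w j ≤ (A *ᵥ w) i :=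
      Finset.single_le_sum (f := fun j => A i j * w j) (fun j _ => mul_nonneg (hA i j) (hw0 j))
        (Finset.mem_univ j)
    have h2 := (mul_pos hij hj).trans_le (h1.trans (hw i))
    exact pos_of_mul_pos_right h2 hρ0
  have hex : 0 < w 0 ∨ 0 < w 1 ∨ 0 < w 2 := by
    by_contra! h
    rw [Fin.sum_univ_three] at hw1
    linarith [h.1, h.2.1, h.2.2]
  have hpos : 0 < w 0 ∧ 0 < w 2 ∧ (0 < w 1 ∨ ∀ j, A 1 j = 0) := by
    rcases hirr with h12 | ⟨hz, h02⟩
    · have h0 : 0 < w 0 := by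
        rcases hex with h | h | h
        · exact h
        · exact hstep 0 1 h01 h
        · exact hstep 0 1 h01 (hstep 1 2 h12 h)
      have h2 := hstep 2 0 h20 h0
      exact ⟨h0, h2, Or.inl (hstep 1 2 h12 h2)⟩
    · have h0 : 0 < w 0 := by
        rcases hex with h | h | h
        · exact h
        · exact hstep 0 1 h01 h
        · exact hstep 0 2 h02 h
      exact ⟨h0, hstep 2 0 h20 h0, Or.inr hz⟩
  obtain ⟨w0, w2, hw1'⟩ := hpos
  have hρpos : 0 < ρ := by
    have h1 : A 2 2 * w 2 ≤ (A *ᵥ w) 2 :=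
      Finset.single_le_sum (f := fun j => A 2 j * w j) (fun j _ => mul_nonneg (hA 2 j) (hw0 j))
        (Finset.mem_univ 2)
    exact pos_of_mul_pos_left ((mul_pos h22 w2).trans_le (h1.trans (hw 2))) w2.le
  -- The comparison starts at time `1`: if `w 1 = 0`, row `1` of `A` vanishes, so `e 1 1 = 0`,
  -- whereas `e 0 1` may be positive. The division by `ρ` in the final constant undoes this shift.
  obtain ⟨K, hK0, hK⟩ : ∃ K, 0 ≤ K ∧ ∀ i, e 1 i ≤ K * w i := by
    have hq : ∀ i, 0 ≤ e 1 i / w i := fun i => div_nonneg (he0 1 i) (hw0 i)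
    refine ⟨∑ i, e 1 i / w i, Finset.sum_nonneg fun i _ => hq i, fun i => ?_⟩
    have hle : e 1 i / w i ≤ ∑ i, e 1 i / w i :=
      Finset.single_le_sum (f := fun i => e 1 i / w i) (fun i _ => hq i) (Finset.mem_univ i)
    by_cases hi : 0 < w i
    · exact (div_le_iff₀ hi).1 hle
    · have hz : ∀ j, A i j = 0 := by
        fin_cases i
        · exact absurd w0 hi
        · exact hw1'.resolve_left hi
        · exact absurd w2 hi
      refine (he 0 i).trans ?_
      have : (A *ᵥ e 0) i = 0 := by simp [Matrix.mulVec, dotProduct, hz]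
      rw [this]
      exact mul_nonneg (Finset.sum_nonneg fun i _ => hq i) (hw0 i)
  have hbound : ∀ k i, e (k + 1) i ≤ K * ρ ^ k * w i := fun k => by
    induction k with
    | zero => simpa using hK
    | succ k ih =>
      intro i
      calc e (k + 1 + 1) i ≤ ∑ j, A i j * e (k + 1) j := he (k + 1) i
        _ ≤ ∑ j, A i j * (K * ρ ^ k * w j) :=
            Finset.sum_le_sum fun j _ => mul_le_mul_of_nonneg_left (ih j) (hA i j)
        _ = K * ρ ^ k * (A *ᵥ w) i := by
            rw [Matrix.mulVec, dotProduct, Finset.mul_sum]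
            exact Finset.sum_congr rfl fun j _ => by ring
        _ ≤ K * ρ ^ k * (ρ * w i) := by
            gcongr
            exact hw i
        _ = K * ρ ^ (k + 1) * w i := by ring
  have hO : (fun k => e k i) =O[Filter.atTop] (fun k : ℕ => ρ ^ k) := by
    refine Asymptotics.IsBigO.of_bound (K * w i / ρ) ?_
    filter_upwards [Filter.eventually_ge_atTop 1] with k hk
    obtain ⟨m, rfl⟩ := Nat.exists_eq_add_of_le' hk
    rw [Real.norm_of_nonneg (he0 _ _), Real.norm_of_nonneg (by positivity)]
    refine (hbound m i).trans_eq ?_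
    rw [pow_succ]
    field_simp
  exact ⟨hO.trans_tendsto (tendsto_pow_atTop_nhds_zero_of_lt_one hρ0 hρ1), hO⟩

/-! ### The transition matrix -/

section Transition

variable {n p : ℕ} {μ L α : ℝ}
  {R C : Matrix (Fin n) (Fin n) ℝ} {u v : Fin n → ℝ} {NR NC : Seminorm ℝ (Fin n → ℝ)}
  {δRC δC2 : ℝ}

/-- If `σ_R = 0`, then `c₁ = 0` and the only surviving term of `c₂` has the factor `‖u - 1‖₂`; were
it zero too, the denominator would vanish. These are the two cases of `linearRate_of_le_mulVec`. -/
theorem sigmaR_pos_or_of_boundDenom_pos (h : 0 < boundDenom R C u v NR NC δRC δC2 μ L) :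
    0 < sigmaR R u NR ∨ sigmaR R u NR = 0 ∧ 0 < l2 n (u - 1) := by
  rcases (inducedNorm_nonneg NR (R - (1 / (n : ℝ)) • Matrix.vecMulVec 1 u)).eq_or_lt with hs | hs
  · refine Or.inr ⟨hs.symm, (apply_nonneg _ _).lt_of_ne fun hu => ?_⟩
    have hs' : sigmaR R u NR = 0 := hs.symm
    simp [boundDenom, c₁, c₂, hs', ← hu] at h
  · exact Or.inl hs

/-- The step size condition makes `det (1 - A)` positive and the diagonal of `A` less than `1`. -/
theorem transitionMatrix_spec (hn : 0 < n) (hμ : 0 < μ) (hμL : μ ≤ L) (hu : IsLeftVec R u)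
    (hv : IsRightVec C v) (hN : AdmissibleNorms p R C u v NR NC δRC δC2)
    (hD : 0 < boundDenom R C u v NR NC δRC δC2 μ L) (hα : 0 < α)
    (hstep : α ≤ stepBound R C u v NR NC δRC δC2 μ L) (hα' : effStep u v α ≤ 2 / (μ + L)) :
    0 < u ⬝ᵥ v ∧ (∀ i j, 0 ≤ transitionMatrix R C u v NR NC δRC δC2 μ L α i j) ∧
      specRadius (transitionMatrix R C u v NR NC δRC δC2 μ L α) < 1 := by
  have hL : 0 < L := hμ.trans_le hμL
  have hn' : (0 : ℝ) < n := by exact_mod_cast hn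
  have hs0 : 0 ≤ sigmaR R u NR := inducedNorm_nonneg _ _
  have hc0 : 0 ≤ sigmaC C v NC := inducedNorm_nonneg _ _
  have hs1 := hN.sigmaR_lt_one
  have hc1 := hN.sigmaC_lt_one
  have hδ := hN.δRC_pos
  have hη := hN.δC2_pos
  have huv : 0 ≤ u ⬝ᵥ v := Finset.sum_nonneg fun i _ => mul_nonneg (hu.nonneg i) (hv.nonneg i)
  have he : 0 ≤ l2 n (u - 1) := apply_nonneg _ _
  have hg : 0 ≤ NR (v - 1) := apply_nonneg _ _
  have hh : 0 ≤ l2 n (R *ᵥ v) := apply_nonneg _ _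
  have hb : 0 ≤ opNorm2 (R - 1) := opNorm2_nonneg _
  have ho : 0 ≤ opNorm2 R := opNorm2_nonneg _
  have h1s : 0 ≤ 1 - sigmaR R u NR := by linarith
  have h1c : 0 ≤ 1 - sigmaC C v NC := by linarith
  have hc₁ : 0 ≤ c₁ R C u v NR NC δRC δC2 μ L := by unfold c₁; positivity
  have hc₃ : 0 ≤ c₃ R C u v NR NC μ := by unfold c₃; positivity
  obtain ⟨hc₃', hquad⟩ := quadratic_le_of_le_root hc₁ hc₃ hD hα (hstep.trans (min_le_left _ _))
  -- A positive step size below the bound forces `c₃ > 0`, which excludes `uᵀv = 0`.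
  have hT : 0 < u ⬝ᵥ v := huv.lt_of_ne fun h => by simp [c₃, ← h] at hc₃'
  have hstep2 : 2 * sigmaC C v NC * δC2 * opNorm2 R * L * α ≤ 1 - sigmaC C v NC := by
    have h2 := hstep.trans (min_le_right _ _)
    have hden : 0 ≤ 2 * sigmaC C v NC * δC2 * opNorm2 R * L := by positivity
    rcases hden.eq_or_lt with h0 | h0
    · rw [← h0, zero_mul]; exact h1c
    · rw [mul_comm]; exact (le_div_iff₀ h0).1 h2
  have hmat : transitionMatrix R C u v NR NC δRC δC2 μ L α =
      !![1 - α * ((u ⬝ᵥ v) / n) * μ, α * ((u ⬝ᵥ v) / n) * L * (1 / √n),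
          α * l2 n (u - 1) * (1 / n);
        α * sigmaR R u NR * NR (v - 1) * L,
          sigmaR R u NR * (1 + α * NR (v - 1) * (L * (1 / √n))), α * sigmaR R u NR * δRC;
        α * sigmaC C v NC * δC2 * l2 n (R *ᵥ v) * L ^ 2,
          sigmaC C v NC * δC2 * L * (opNorm2 (R - 1) + α * l2 n (R *ᵥ v) * (L * (1 / √n))),
          sigmaC C v NC * (1 + α * δC2 * opNorm2 R * L)] := by
    have e1 : effStep u v α = α * ((u ⬝ᵥ v) / n) := by unfold effStep; ring
    unfold transitionMatrix
    simp only [e1, mul_one_div]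
  obtain ⟨d1, d2, hdet⟩ := det_one_sub_pos (T := (u ⬝ᵥ v) / n) (l := 1 / √n) (k := 1 / n)
    (e := l2 n (u - 1)) (g := NR (v - 1)) (h := l2 n (R *ᵥ v)) (b := opNorm2 (R - 1))
    (o := opNorm2 R) hs0 hs1 hc0 hc1 (by positivity) he hg hh hb ho hδ.le hη.le hμ hμL hα
    (by positivity) (by positivity) (by
      refine le_trans (le_of_eq ?_) (hquad.trans (le_of_eq ?_))
      · unfold c₁ c₂
        ring
      · unfold c₃
        ring) hstep2
  rw [← hmat] at hdet
  have ht : 0 < effStep u v α := mul_pos (by positivity) hT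
  have htL : effStep u v α * (μ + L) ≤ 2 := (le_div_iff₀ (by linarith)).1 hα'
  have h1t : 0 ≤ 1 - effStep u v α * μ := by nlinarith
  have hnonneg : ∀ i j, 0 ≤ transitionMatrix R C u v NR NC δRC δC2 μ L α i j := fun i j => by
    fin_cases i <;> fin_cases j <;> simp [transitionMatrix] <;> first | positivity | linarith
  refine ⟨hT, hnonneg, specRadius_lt_one_of_det_pos hnonneg (fun i => ?_) hdet⟩
  rw [hmat]
  fin_cases i
  · have : 0 < α * ((u ⬝ᵥ v) / n) * μ := by positivity
    simpa using this
  · simpa using d1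
  · simpa using d2

/-- The positive diagonal gives `(R v) i ≥ R i i * v i`, so `R v = 0` would force `v = 0`, against
the sum `n`. It makes the entry `(2, 0)` of the transition matrix positive. -/
theorem l2_mulVec_pos (hn : 0 < n) (hRC : MixingMatrices R C) (hv : IsRightVec C v) :
    0 < l2 n (R *ᵥ v) := by
  refine (apply_nonneg _ _).lt_of_ne fun h => ?_
  have h0 := l2_eq_zero h.symm
  have hz : ∀ i, v i = 0 := fun i => by
    have h1 : R i i * v i ≤ (R *ᵥ v) i :=
      Finset.single_le_sum (f := fun j => R i j * v j)
        (fun j _ => mul_nonneg (hRC.R_nonneg i j) (hv.nonneg j)) (Finset.mem_univ i)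
    rw [h0, Pi.zero_apply] at h1
    nlinarith [hRC.R_diag i, hv.nonneg i]
  have := hv.sum_eq
  simp only [hz, Finset.sum_const_zero] at this
  exact hn.ne (by exact_mod_cast this)

end Transition

end PushPull

end

theorem theorem1 {n p : ℕ} (hp : 0 < p) (μ L : ℝ) (hμ : 0 < μ)
    (f : Fin n → EuclideanSpace ℝ (Fin p) → ℝ) (R C : Matrix (Fin n) (Fin n) ℝ)
    (hf : PushPull.StronglyConvexSmooth f μ L) (hRC : PushPull.MixingMatrices R C) :
    -- the optimal solution, the eigenvectors and the norms that occur below exist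
    (∃! xs, PushPull.IsOptimal f xs) ∧
    (∃! u, PushPull.IsLeftVec R u) ∧
    (∃! v, PushPull.IsRightVec C v) ∧
    ∀ u v : Fin n → ℝ, PushPull.IsLeftVec R u → PushPull.IsRightVec C v →
      (∃ (NR NC : Seminorm ℝ (Fin n → ℝ)) (δRC δC2 : ℝ),
        PushPull.AdmissibleNorms p R C u v NR NC δRC δC2) ∧
      -- linear convergence, for every admissible choice of the norms
      ∀ (NR NC : Seminorm ℝ (Fin n → ℝ)) (δRC δC2 : ℝ),
        PushPull.AdmissibleNorms p R C u v NR NC δRC δC2 →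
        -- the two quotients in the step size bound are meaningful
        0 < PushPull.sigmaC C v NC →
        0 < PushPull.boundDenom R C u v NR NC δRC δC2 μ L →
        ∀ α : ℝ, 0 < α →
          α ≤ PushPull.stepBound R C u v NR NC δRC δC2 μ L →
          PushPull.effStep u v α ≤ 2 / (μ + L) →
          PushPull.specRadius
              (PushPull.transitionMatrix R C u v NR NC δRC δC2 μ L α) < 1 ∧
          ∀ (xs : EuclideanSpace ℝ (Fin p)) (X₀ : Matrix (Fin n) (Fin p) ℝ),
            PushPull.IsOptimal f xs →
            PushPull.LinearRate
              (fun k => PushPull.optError u xs (PushPull.iter f R C α X₀ k).1)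
              (PushPull.specRadius
                (PushPull.transitionMatrix R C u v NR NC δRC δC2 μ L α)).toReal ∧
            PushPull.LinearRate
              (fun k => PushPull.consError NR u (PushPull.iter f R C α X₀ k).1)
              (PushPull.specRadius
                (PushPull.transitionMatrix R C u v NR NC δRC δC2 μ L α)).toReal ∧
            PushPull.LinearRate
              (fun k => PushPull.trackError NC v (PushPull.iter f R C α X₀ k).2)
              (PushPull.specRadius
                (PushPull.transitionMatrix R C u v NR NC δRC δC2 μ L α)).toReal := by
  obtain ⟨r, hrR, hrC⟩ := hRC.common_root
  -- The common root supplies `n ≥ 1`.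
  have hn : 0 < n := r.pos
  have hμL := hf.le hn hp
  have hL : 0 < L := hμ.trans_le hμL
  refine ⟨hf.existsUnique_isOptimal hn hp hμ,
    PushPull.existsUnique_isLeftVec hRC.R_nonneg hRC.R_row hRC.R_diag hrR, ?_, ?_⟩
  · simp only [PushPull.IsRightVec.transpose]
    exact PushPull.existsUnique_isLeftVec (fun i j => hRC.C_nonneg j i)
      (by rw [Matrix.mulVec_transpose]; exact hRC.C_col) hRC.C_diag hrC
  intro u v hu hv
  refine ⟨PushPull.exists_admissibleNorms p hRC hu hv, ?_⟩
  intro NR NC δRC δC2 hN hσC hD α hα hstep hα'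
  obtain ⟨huv, hnonneg, hρ⟩ :=
    PushPull.transitionMatrix_spec hn hμ hμL hu hv hN hD hα hstep hα'
  refine ⟨hρ, fun xs X₀ hxs => ?_⟩
  have hn' : (0 : ℝ) < n := by exact_mod_cast hn
  have hδ := hN.δRC_pos
  have hη := hN.δC2_pos
  have hRv := PushPull.l2_mulVec_pos hn hRC hv
  have ho := PushPull.opNorm2_nonneg R
  have ht : 0 < PushPull.effStep u v α := mul_pos (by positivity) huv
  have hrate := PushPull.linearRate_of_le_mulVec hnonneg hρ
    (by simp only [PushPull.transitionMatrix]; simp; positivity)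
    (by simp only [PushPull.transitionMatrix]; simp; positivity)
    (by simp only [PushPull.transitionMatrix]; simp; positivity)
    (by
      rcases PushPull.sigmaR_pos_or_of_boundDenom_pos hD with hs | ⟨hs, he⟩
      · left
        simp only [PushPull.transitionMatrix]
        simp
        positivity
      · right
        refine ⟨fun j => ?_, ?_⟩
        · fin_cases j <;> simp [PushPull.transitionMatrix, hs]
        · simp only [PushPull.transitionMatrix]
          simp
          positivity)
    (PushPull.errors_nonneg xs X₀)
    (PushPull.errors_succ_le hf hn hp hμ hRC hu hv hN hα.le hα' hxs X₀)
  exact ⟨hrate 0, hrate 1, hrate 2⟩
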